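/- Let $C\subset\mathbb{R}^2$ be a compact convex set with non-empty interior, let $\mathcal S$ be the family of all translates of $C$, and let $\zeta$ be the independent kissing number of $\mathcal S$, that is, the maximum size of a set of pairwise disjoint members of $\mathcal S$ that all intersect a common further member $u\in\mathcal S$. In the online minimum connected dominating set (MCDS) problem for $\mathcal S$, the members of a finite sequence $\sigma$ of distinct objects of $\mathcal S$ are revealed one by one, in such a way that after every step the intersection graph of the objects revealed so far is connected. After every step a deterministic online algorithm, whose decisions depend only on the objects revealed so far, must hold a connected dominating set of that intersection graph. It may add any revealed objects (new or old) to its solution but may never remove one. Let $\mathrm{ALG}(\sigma)$ be the size of its final solution and let $opt_{cds}(\sigma)$ be the minimum size of a connected dominating set of the intersection graph of all objects in $\sigma$. Then every deterministic online algorithm $\mathrm{ALG}$ satisfies: (i) if $\alpha\in\mathbb{R}$ is such that $\mathrm{ALG}(\sigma)\le\alpha\, opt_{cds}(\sigma)$ for all input sequences $\sigma$ with $opt_{cds}(\sigma)=1$, then $\alpha\ge 2(\zeta-1)$; (ii) for every $k\in\mathbb{N}$, if $\alpha\in\mathbb{R}$ is such that $\mathrm{ALG}(\sigma)\le\alpha\,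 opt_{cds}(\sigma)$ for all input sequences $\sigma$ with $opt_{cds}(\sigma)\ge k$, then $\alpha\ge\frac{2\zeta-1}{3}$. In other words, the competitive ratio is at least $2(\zeta-1)$ on inputs with $opt_{cds}=1$, and at least $\frac{2\zeta-1}{3}$ in general, even when restricted to inputs whose optimum exceeds any given bound. -/

import Mathlib

/-- The Euclidean plane. -/
abbrev Plane : Type := EuclideanSpace ℝ (Fin 2)

/-- A convex object: a compact convex set with non-empty interior. -/
structure IsConvexObject (C : Set Plane) : Prop where
  isCompact : IsCompact C
  convex : Convex ℝ C
  interior_nonempty : (interior C).Nonempty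

/-- The family of all translated copies of `C`. -/
def translates (C : Set Plane) : Set (Set Plane) :=
  Set.range fun v : Plane => (fun x => v + x) '' C

/-- The geometric intersection graph of a family of objects: the vertices are the objects, and two
distinct objects are adjacent iff they intersect. -/
def intersectionGraph (S : Set (Set Plane)) : SimpleGraph S where
  Adj u v := u ≠ v ∧ ((u : Set Plane) ∩ (v : Set Plane)).Nonempty
  symm := ⟨fun _ _ h => ⟨h.1.symm, by rw [Set.inter_comm]; exact h.2⟩⟩
  loopless := ⟨fun _ h => h.1 rfl⟩

/-- An independent kissing configuration in the family `S` with core `u` and independent set `I`: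
`u` intersects all objects of `I`, and the objects of `I` are pairwise non-touching (disjoint). -/
structure IsIndependentKissingConfiguration (S : Set (Set Plane)) (u : S) (I : Finset S) :
    Prop where
  core_notMem : u ∉ I
  intersects_core : ∀ v ∈ I, ((u : Set Plane) ∩ (v : Set Plane)).Nonempty
  nontouching : ∀ v ∈ I, ∀ w ∈ I, v ≠ w → Disjoint (v : Set Plane) (w : Set Plane)

/-- `ζ` is the independent kissing number of the family `S`: the maximum, over all cores, of the
size of the independent set of an independent kissing configuration. -/
def IsIndependentKissingNumber (S : Set (Set Plane)) (ζ : ℕ) : Prop :=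
  IsGreatest
    {n : ℕ | ∃ (u : S) (I : Finset S), IsIndependentKissingConfiguration S u I ∧ I.card = n} ζ

section OnlineCDS

variable {V : Type*} (G : SimpleGraph V)

/-- `D` is a connected dominating set of the subgraph of `G` induced by `U`. -/
structure IsConnectedDominatingSet (U : Set V) (D : Finset V) : Prop where
  subset : ∀ v ∈ D, v ∈ U
  dominating : ∀ v ∈ U, v ∈ D ∨ ∃ w ∈ D, G.Adj v w
  connected : (G.induce {v | v ∈ D}).Connected

/-- The size of a minimum connected dominating set of the subgraph of `G` induced by `U`. It is
only used where this subgraph is finite and connected, so that the minimum exists. -/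
noncomputable def optCDS (U : Set V) : ℕ :=
  sInf {n : ℕ | ∃ D : Finset V, IsConnectedDominatingSet G U D ∧ D.card = n}

/-- An input sequence: a non-empty finite sequence of distinct vertices such that the graph
revealed so far is connected after each arrival. -/
structure IsInputSequence (l : List V) : Prop where
  ne_nil : l ≠ []
  nodup : l.Nodup
  connected : ∀ p : List V, p ≠ [] → p <+: l → (G.induce {v | v ∈ p}).Connected

/-- A deterministic online algorithm for the minimum connected dominating set problem in the vertex
arrival model. `solution l` is the solution held after the sequence `l` has been revealed; it
depends on `l` only, is a connected dominating set of the revealed graph, and no vertex is ever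
removed from it. Any revealed vertex, new or old, may be added after an arrival. -/
structure OnlineCDSAlgorithm where
  solution : List V → Finset V
  feasible : ∀ l : List V, IsInputSequence G l →
    IsConnectedDominatingSet G {v | v ∈ l} (solution l)
  irrevocable : ∀ (l : List V) (v : V), l ≠ [] → IsInputSequence G (l ++ [v]) →
    solution l ⊆ solution (l ++ [v])

variable {G}

/-- The algorithm `A` is `α`-competitive (in the absolute sense) on all input sequences whose
optimum value satisfies `P`. -/
def OnlineCDSAlgorithm.IsCompetitive (A : OnlineCDSAlgorithm G) (P : ℕ → Prop) (α : ℝ) : Prop :=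
  ∀ l : List V, IsInputSequence G l → P (optCDS G {v | v ∈ l}) →
    ((A.solution l).card : ℝ) ≤ α * (optCDS G {v | v ∈ l} : ℝ)

end OnlineCDS

/-! ### Induced subgraphs and input sequences -/

section Graph

variable {V : Type*} {G : SimpleGraph V}

/-! Let `p` be the norm with unit ball `C - C`: the translates by `v` and `w` meet iff `p (v - w) ≤
1`. A largest independent kissing configuration becomes ζ points of the unit ball at pairwise
distances greater than 1. Radial projection keeps them separated, so on the unit circle the map
`farthest`, which sends an angle to the last one ahead at distance at most 1, goes less than once
around in ζ iterations from a suitable angle.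

These iterations are refined to an induced path on 2ζ - 1 points of the circle. From `t`, go to some
`w ≤ farthest p t` whose image lies just beyond `farthest p t`, then to that image: the outer two
points are not adjacent, and the two edges cost barely more than one step of `farthest`. Such a `w`
exists because values of `farthest` accumulate from the right at each of its values
(`exists_farthest_mem_Ioo`); otherwise the circle would contain a configuration excluded by
`Seminorm.false_of_unit_configuration`. All steps but one are doubled in this way; the last one
closes up the circle. Shrinking the inner points slightly gives an `IsKissingPath`.

An induced path presented in order forces every vertex but the last into the solution
(`IsInducedPath.mem_solution`), since a new end can be dominated or connected only through its
predecessor. For (i), the centre of the ball arrives afterwards and dominates everything. For (ii),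
many copies of the path, alternately point-reflected, are strung together at their ends. As only the
ends lie on the unit circle, no unwanted edges arise and the whole is one induced path; then the
centres arrive. Two ends and a centre per block suffice for the optimum, while the algorithm takes
all 2ζ - 1 path vertices per block, up to one in total. The centres are at distance at least 3, so
the optimum grows with the number of blocks. -/

theorem induce_singleton_connected (v : V) : (G.induce {w | w = v}).Connected :=
  haveI : Nonempty {w | w = v} := ⟨⟨v, rfl⟩⟩
  ⟨fun a b => by
    have : a = b := Subtype.ext ((show a.1 = v from a.2).trans (show b.1 = v from b.2).symm)
    rw [this]⟩

theorem induce_insert_connected {s t : Set V} {v w : V} (hs : (G.induce s).Connected)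
    (hw : w ∈ s) (h : G.Adj v w) (ht : ∀ x, x ∈ t ↔ x ∈ s ∨ x = v) :
    (G.induce t).Connected := by
  have e : t = s ∪ {w, v} := by
    ext x
    simp only [ht, Set.mem_union, Set.mem_insert_iff, Set.mem_singleton_iff]
    constructor
    · tauto
    · rintro (h | rfl | h) <;> tauto
  rw [e]
  exact SimpleGraph.induce_union_connected hs.preconnected
    (SimpleGraph.induce_pair_connected_of_adj h.symm).preconnected ⟨w, hw, by simp⟩

theorem induce_walk_connected (z : ℕ → V) (n : ℕ)
    (h : ∀ k, k < n → G.Adj (z k) (z (k + 1))) :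
    (G.induce {v | ∃ k, k ≤ n ∧ z k = v}).Connected := by
  induction n with
  | zero =>
    have : {v | ∃ k, k ≤ 0 ∧ z k = v} = {w | w = z 0} := by
      ext v; simp [eq_comm]
    rw [this]
    exact induce_singleton_connected _
  | succ n ih =>
    refine induce_insert_connected (ih fun k hk => h k (by omega)) (w := z n) (v := z (n + 1))
      ⟨n, le_rfl, rfl⟩ (h n (by omega)).symm fun x => ?_
    constructor
    · rintro ⟨k, hk, rfl⟩
      rcases Nat.lt_or_ge n k with h | h
      · right; congr 1; omega
      · exact Or.inl ⟨k, h, rfl⟩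
    · rintro (⟨k, hk, rfl⟩ | rfl)
      · exact ⟨k, by omega, rfl⟩
      · exact ⟨n + 1, le_rfl, rfl⟩

theorem SimpleGraph.Reachable.exists_adj_of_ne {v w : V} (h : G.Reachable v w) (hne : v ≠ w) :
    ∃ x, G.Adj v x := by
  obtain ⟨p⟩ := h
  cases p with
  | nil => exact absurd rfl hne
  | cons e _ => exact ⟨_, e⟩

theorem isInputSequence_singleton (v : V) : IsInputSequence G [v] where
  ne_nil := by simp
  nodup := by simp
  connected p hp h := by
    have : p = [v] := by
      rcases List.prefix_cons_iff.1 h with rfl | ⟨t, rfl, ht⟩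
      · exact absurd rfl hp
      · simp [List.prefix_nil.1 ht]
    subst this
    have : {w | w ∈ [v]} = {w | w = v} := by ext; simp
    rw [this]
    exact induce_singleton_connected v

theorem IsInputSequence.append_singleton {l : List V} (hl : IsInputSequence G l) {v w : V}
    (hv : v ∉ l) (hw : w ∈ l) (h : G.Adj v w) : IsInputSequence G (l ++ [v]) where
  ne_nil := by simp
  nodup := by
    rw [List.nodup_append]
    refine ⟨hl.nodup, by simp, fun a ha b hb hab => hv ?_⟩
    rw [List.mem_singleton.1 hb] at hab
    exact hab ▸ ha
  connected p hp h' := by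
    rcases List.prefix_concat_iff.1 h' with rfl | h'
    · exact induce_insert_connected (hl.connected l hl.ne_nil List.prefix_rfl) hw h
        fun x => by simp
    · exact hl.connected p hp h'

/-- The first `n` terms of `y` form an induced path of `G`, in this order. -/
structure IsInducedPath (G : SimpleGraph V) (y : ℕ → V) (n : ℕ) : Prop where
  adj : ∀ i, i + 1 < n → G.Adj (y i) (y (i + 1))
  not_adj : ∀ i j, i + 2 ≤ j → j < n → ¬ G.Adj (y i) (y j)
  ne : ∀ i j, i < j → j < n → y i ≠ y j

theorem IsInducedPath.mono {y : ℕ → V} {m n : ℕ} (h : IsInducedPath G y n) (hmn : m ≤ n) :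
    IsInducedPath G y m where
  adj i hi := h.adj i (by omega)
  not_adj i j hij hj := h.not_adj i j hij (by omega)
  ne i j hij hj := h.ne i j hij (by omega)

theorem IsInducedPath.isInputSequence {y : ℕ → V} {n : ℕ} (h : IsInducedPath G y (n + 1)) :
    IsInputSequence G ((List.range (n + 1)).map y) := by
  induction n with
  | zero => simpa using isInputSequence_singleton (G := G) (y 0)
  | succ n ih =>
    rw [List.range_succ, List.map_append]
    refine (ih (h.mono (by omega))).append_singleton (w := y n) ?_ ?_ (h.adj n (by omega)).symm
    · simp only [List.mem_map, List.mem_range, not_exists, not_and]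
      exact fun i hi => h.ne i _ hi (by omega)
    · exact List.mem_map.2 ⟨n, by simp, rfl⟩

/-- On an induced path, all vertices but the last one are forced into the solution. -/
theorem IsInducedPath.mem_solution {y : ℕ → V} {n : ℕ} (h : IsInducedPath G y (n + 1))
    (A : OnlineCDSAlgorithm G) :
    ∀ i, (i < n ∨ i = 0) → y i ∈ A.solution ((List.range (n + 1)).map y) := by
  induction n with
  | zero =>
    intro i hi
    obtain rfl : i = 0 := by omega
    have hf := A.feasible _ h.isInputSequence
    obtain ⟨⟨v, hv⟩⟩ := hf.connected.nonempty
    have := hf.subset v hv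
    simp only [zero_add, List.range_one, List.map_cons, List.map_nil, List.mem_singleton,
      Set.mem_ofPred_eq] at this
    exact this ▸ hv
  | succ n ih =>
    have hs : A.solution ((List.range (n + 1)).map y) ⊆
        A.solution ((List.range (n + 1 + 1)).map y) := by
      have h' := h.isInputSequence
      rw [List.range_succ (n := n + 1), List.map_append] at h' ⊢
      exact A.irrevocable _ _ (by simp) h'
    have ih := ih (h.mono (by omega))
    intro i hi
    by_cases hin : i < n ∨ i = 0
    · exact hs (ih i hin)
    obtain rfl : i = n := by omega
    have hf := A.feasible _ h.isInputSequence
    -- If the new end is itself in the solution, connectedness to `y 0` gives it a neighbour there;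
    -- otherwise domination does. Its only neighbour is its predecessor. This is why `i = 0` is kept
    -- in the induction even for a one-vertex path.
    have key : ∃ w ∈ A.solution ((List.range (i + 1 + 1)).map y), G.Adj (y (i + 1)) w := by
      by_cases hl : y (i + 1) ∈ A.solution ((List.range (i + 1 + 1)).map y)
      · have h0 : y 0 ∈ A.solution ((List.range (i + 1 + 1)).map y) := hs (ih 0 (by omega))
        have hne : y 0 ≠ y (i + 1) := h.ne 0 _ (by omega) (by omega)
        obtain ⟨⟨w, hw⟩, hadj⟩ := (hf.connected.preconnected ⟨_, hl⟩ ⟨_, h0⟩).exists_adj_of_ne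
          fun e => hne (congrArg Subtype.val e).symm
        exact ⟨w, hw, hadj⟩
      · exact (hf.dominating _ (List.mem_map.2 ⟨i + 1, by simp, rfl⟩)).resolve_left hl
    obtain ⟨w, hw, hadj⟩ := key
    obtain ⟨j, hj, rfl⟩ := List.mem_map.1 (hf.subset w hw)
    rw [List.mem_range] at hj
    rcases Nat.lt_trichotomy j i with hji | rfl | hji
    · exact absurd hadj.symm (h.not_adj j (i + 1) (by omega) (by omega))
    · exact hw
    · obtain rfl : j = i + 1 := by omega
      exact absurd hadj (G.loopless.irrefl _)

theorem IsInputSequence.solution_subset {A : OnlineCDSAlgorithm G} {l m : List V}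
    (hl : l ≠ []) (h : IsInputSequence G (l ++ m)) : A.solution l ⊆ A.solution (l ++ m) := by
  induction m using List.reverseRecOn with
  | nil => simp
  | append_singleton m v ih =>
    rw [← List.append_assoc] at h ⊢
    have h' : IsInputSequence G (l ++ m) :=
      ⟨by simp [hl], (List.nodup_append.1 h.nodup).1,
        fun p hp hpl => h.connected p hp (hpl.trans (List.prefix_append _ _))⟩
    exact (ih h').trans (A.irrevocable _ _ (by simp [hl]) h)

/-- If the vertices `u 0, …, u (N - 1)` arrive after an induced path on `n + 1` vertices, the online
solution has at least `n` vertices. -/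
theorem IsInducedPath.exists_isInputSequence {y : ℕ → V} {n : ℕ} (h : IsInducedPath G y (n + 1))
    (A : OnlineCDSAlgorithm G) (u : ℕ → V) (N : ℕ)
    (hu : ∀ j, j < N → ∃ i, i ≤ n ∧ G.Adj (u j) (y i))
    (huy : ∀ j, j < N → ∀ i, i ≤ n → u j ≠ y i) (huu : ∀ i j, i < j → j < N → u i ≠ u j) :
    IsInputSequence G ((List.range (n + 1)).map y ++ (List.range N).map u) ∧
      n ≤ (A.solution ((List.range (n + 1)).map y ++ (List.range N).map u)).card := by
  have hseq : IsInputSequence G ((List.range (n + 1)).map y ++ (List.range N).map u) := by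
    induction N with
    | zero => simpa using h.isInputSequence
    | succ N ih =>
      rw [List.range_succ (n := N), List.map_append, ← List.append_assoc]
      obtain ⟨i, hi, hadj⟩ := hu N (by omega)
      refine (ih (fun j hj => hu j (by omega)) (fun j hj => huy j (by omega))
        fun i j hij hj => huu i j hij (by omega)).append_singleton (w := y i) ?_ ?_ hadj
      · simp only [List.mem_append, List.mem_map, List.mem_range, not_or, not_exists, not_and]
        exact ⟨fun i hi e => huy N (by omega) i (by omega) e.symm,
          fun i hi => huu i N hi (by omega)⟩
      · exact List.mem_append_left _ (List.mem_map.2 ⟨i, by simp; omega, rfl⟩)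
  refine ⟨hseq, ?_⟩
  classical
  calc n = ((Finset.range n).image y).card := by
        rw [Finset.card_image_of_injOn, Finset.card_range]
        intro i hi j hj hij
        simp only [Finset.coe_range, Set.mem_Iio] at hi hj
        rcases Nat.lt_trichotomy i j with hlt | rfl | hlt
        · exact absurd hij (h.ne i j hlt (by omega))
        · rfl
        · exact absurd hij.symm (h.ne j i hlt (by omega))
    _ ≤ _ := by
        refine Finset.card_le_card fun v hv => ?_
        obtain ⟨i, hi, rfl⟩ := Finset.mem_image.1 hv
        exact hseq.solution_subset (by simp)
          (h.mem_solution A i (Or.inl (Finset.mem_range.1 hi)))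

theorem optCDS_le {U : Set V} {D : Finset V} (h : IsConnectedDominatingSet G U D) :
    optCDS G U ≤ D.card :=
  Nat.sInf_le ⟨D, h, rfl⟩

/-- The witness `D` excludes the junk value `sInf ∅ = 0`. -/
theorem le_optCDS {U : Set V} {D : Finset V} (h : IsConnectedDominatingSet G U D) {k : ℕ}
    (hk : ∀ D', IsConnectedDominatingSet G U D' → k ≤ D'.card) : k ≤ optCDS G U :=
  le_csInf ⟨_, D, h, rfl⟩ (by rintro _ ⟨D', hD', rfl⟩; exact hk D' hD')

theorem IsConnectedDominatingSet.card_pos {U : Set V} {D : Finset V}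
    (h : IsConnectedDominatingSet G U D) : 0 < D.card := by
  obtain ⟨⟨v, hv⟩⟩ := h.connected.nonempty
  exact Finset.card_pos.2 ⟨v, hv⟩

end Graph

/-! ### The unit circle of a planar norm -/

section Seminorm

variable {E : Type*} [AddCommGroup E] [Module ℝ E] (p : Seminorm ℝ E)

theorem Seminorm.map_smul_of_nonneg {a : ℝ} (ha : 0 ≤ a) (x : E) : p (a • x) = a * p x := by
  rw [map_smul_eq_mul, Real.norm_of_nonneg ha]

theorem Seminorm.le_of_smul_eq {a b c : ℝ} {x y z : E} (ha : 0 ≤ a) (hb : 0 ≤ b) (hc : 0 ≤ c)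
    (h : a • x = b • y + c • z) : a * p x ≤ b * p y + c * p z := by
  rw [← p.map_smul_of_nonneg ha, ← p.map_smul_of_nonneg hb, ← p.map_smul_of_nonneg hc, h]
  exact map_add_le_add p _ _

/-- The monotonicity lemma: on the unit circle, the distance from `x` increases towards `-x`. -/
theorem Seminorm.sub_le_sub_of_mem_cone {x y z : E} (hx : p x = 1) (hy : p y = 1) (hz : p z = 1)
    {a b : ℝ} (ha : 0 ≤ a) (hb : 0 ≤ b) (h : y = a • x + b • z) : p (y - x) ≤ p (z - x) := by
  have h1 := p.le_of_smul_eq zero_le_one ha hb (x := y) (y := x) (z := z) (by rw [one_smul, h])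
  rw [hx, hy, hz] at h1
  have h2 := p.le_of_smul_eq (a := a + b) (b := a + b - 1) (c := b) (x := y - x) (y := y)
    (z := z - x) (by linarith) (by linarith) hb (by rw [h]; module)
  -- This yields `a + b - 1 ≤ a * p (z - x)`, which absorbs the error term of the previous
  -- inequality.
  have h3 := p.le_of_smul_eq (a := a + b) (b := 1) (c := a) (x := z) (y := y)
    (z := z - x) (by linarith) (by linarith) ha (by rw [h]; module)
  rw [hy] at h2 h3
  rw [hz] at h3
  have : (a + b) * p (y - x) ≤ (a + b) * p (z - x) := by nlinarith
  exact le_of_mul_le_mul_left this (by linarith)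

/-- Radial projection to the unit sphere keeps distances larger than one. -/
theorem Seminorm.one_lt_sub_normalize {x y : E} (hx : p x ≤ 1) (hy : p y ≤ 1) (hx0 : 0 < p x)
    (hy0 : 0 < p y) (h : 1 < p (x - y)) : 1 < p ((p x)⁻¹ • x - (p y)⁻¹ • y) := by
  have aux : ∀ x y : E, p x ≤ 1 → p y ≤ 1 → 0 < p x → 0 < p y → p y ≤ p x → 1 < p (x - y) →
      1 < p ((p x)⁻¹ • x - (p y)⁻¹ • y) := by
    intro x y hx hy hx0 hy0 hyx h
    -- With `x'`, `y'` the normalized vectors, `x - y = (p x - p y) • x' + p y • (x' - y')`. If `p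
    -- (x' - y') ≤ 1`, the right side has norm at most `p x ≤ 1`.
    have h1 := p.le_of_smul_eq (a := 1) (b := p x - p y) (c := p y) (x := x - y)
      (y := (p x)⁻¹ • x) (z := (p x)⁻¹ • x - (p y)⁻¹ • y) zero_le_one (by linarith) hy0.le (by
        have e1 : (p x - p y) • (p x)⁻¹ • x = x - (p y) • (p x)⁻¹ • x := by
          rw [sub_smul, smul_smul (p x), mul_inv_cancel₀ hx0.ne', one_smul]
        rw [e1, smul_sub (p y), smul_smul (p y) (p y)⁻¹, mul_inv_cancel₀ hy0.ne']
        module)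
    rw [p.map_smul_of_nonneg (inv_nonneg.2 hx0.le), inv_mul_cancel₀ hx0.ne'] at h1
    by_contra! hc
    nlinarith
  rcases le_total (p y) (p x) with hyx | hyx
  · exact aux x y hx hy hx0 hy0 hyx h
  · rw [map_sub_rev]
    exact aux y x hy hx hy0 hx0 hyx (by rwa [map_sub_rev])

/-- Two long parallel segments on the unit circle cannot be adjacent in the way that would make
the farthest neighbour map jump at the end of an interval of constancy. -/
theorem Seminorm.false_of_unit_configuration {q w y c : E} (hq : p q = 1) (hw : p w = 1)
    (hy : p y = 1) (hyq : p (y - q) = 1) (hyw : p (y - w) = 1)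
    (hcw : p (c - w) ≤ 1) {l m l' m' : ℝ} (hl : 0 < l) (hm : 0 < m) (hl' : 0 < l') (hm' : 0 < m')
    (h : w = l • q + m • y) (h' : y = l' • w + m' • c) : False := by
  have hl1 : l = 1 := by
    have h0 := p.le_of_smul_eq zero_le_one hl.le hm.le (x := w) (y := q) (z := y)
      (by rw [one_smul, h])
    rw [hq, hy, hw] at h0
    have h1 := p.le_of_smul_eq (a := l + m) (b := 1) (c := m) (x := q) (y := w) (z := q - y)
      (by linarith) zero_le_one hm.le (by rw [h]; module)
    have h2 := p.le_of_smul_eq (a := l + m) (b := l) (c := l + m - 1) (x := w - y) (y := q - y)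
      (z := w) (by linarith) hl.le (by linarith) (by rw [h]; module)
    rw [map_sub_rev p q y, hq, hw, hyq] at h1
    rw [map_sub_rev p q y, map_sub_rev p w y, hw, hyq, hyw] at h2
    linarith
  subst hl1
  -- Now `-w`, `y - w`, `y - q` are unit vectors on a line in direction `y`, with `y - w` in the
  -- middle. A functional supporting the ball at `y - w` is 1 on all three and 0 on `y`; then `h'`
  -- makes it positive on `c`, hence greater than 1 on `c - w`. The rest is this argument with
  -- explicit coefficients.
  have hqe : y - q = (1 + m) • y - w := by rw [h]; module
  -- a small multiple of `c - w` is traded against `-w` and `y - q`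
  set d : ℝ := m / ((1 + m) * (1 + l' + m')) with hd
  have hd0 : 0 < d := by positivity
  have hd1 : d * (1 + l' + m') * (1 + m) = m := by rw [hd]; field_simp
  set B : ℝ := (1 - d) / (1 + m) with hB
  have hB1 : B * (1 + m) = 1 - d := by rw [hB]; field_simp
  have hdlt : d < 1 := by nlinarith [mul_pos hd0 hl', mul_pos hd0 hm']
  have hB0 : 0 < B := by have : 0 < 1 - d := by linarith
                         positivity
  set A : ℝ := 1 - d * (l' + m') - B with hA
  have hA0 : 0 ≤ A := by
    have : 0 ≤ A * (1 + m) := by rw [hA, sub_mul, hB1]; nlinarith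
    exact nonneg_of_mul_nonneg_left this (by linarith)
  have e1 : d • y = (d * l') • w + (d * m') • c := by rw [mul_smul, mul_smul, ← smul_add, ← h']
  -- The coefficients on the right sum to `1 - d * l' < 1`, too little for a unit vector; `d` is
  -- small enough to keep `A` nonnegative.
  have e2 : (1 : ℝ) • (y - w) = A • (-w) + (1 : ℝ) • (B • (y - q) + (d * m') • (c - w)) := by
    have e3 : B • (y - q) = y - d • y - B • w := by
      rw [hqe, smul_sub, smul_smul, hB1, sub_smul, one_smul]
    rw [e3, e1, hA]
    module
  have h1 := p.le_of_smul_eq zero_le_one hA0 zero_le_one e2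
  have h2 : p (B • (y - q) + (d * m') • (c - w)) ≤ B * p (y - q) + d * m' * p (c - w) := by
    simpa using p.le_of_smul_eq zero_le_one hB0.le (mul_pos hd0 hm').le
      (one_smul ℝ (B • (y - q) + (d * m') • (c - w)))
  rw [map_neg_eq_map, hw, hyw] at h1
  rw [hyq] at h2
  nlinarith [mul_pos hd0 hm', mul_pos hd0 hl']

end Seminorm

/-! ### Angles on the unit circle and the farthest-neighbour map. -/

section Circle

/-- The direction with angle `t`. -/
noncomputable def direction (t : ℝ) : Plane := !₂[Real.cos t, Real.sin t]

theorem direction_ne_zero (t : ℝ) : direction t ≠ 0 := fun h => by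
  have h0 : Real.cos t = 0 := by simpa [direction] using congrArg (fun v : Plane => v 0) h
  have h1 : Real.sin t = 0 := by simpa [direction] using congrArg (fun v : Plane => v 1) h
  simpa [h0, h1] using Real.cos_sq_add_sin_sq t

theorem continuous_direction : Continuous direction := by
  refine (PiLp.continuous_toLp 2 _).comp (continuous_pi fun i => ?_)
  fin_cases i
  · exact Real.continuous_cos
  · exact Real.continuous_sin

theorem direction_add_pi (t : ℝ) : direction (t + Real.pi) = -direction t := by
  ext i; fin_cases i <;> simp [direction]

theorem direction_combination (s t u : ℝ) :
    Real.sin (u - s) • direction t =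
      Real.sin (u - t) • direction s + Real.sin (t - s) • direction u := by
  ext i
  fin_cases i <;> simp [direction, Real.sin_sub] <;> ring

theorem exists_eq_smul_direction {v : Plane} (hv : v ≠ 0) :
    ∃ t ∈ Set.Ioc (-Real.pi) Real.pi, ∃ r : ℝ, 0 < r ∧ v = r • direction t := by
  set z : ℂ := ⟨v 0, v 1⟩ with hz
  have hz0 : z ≠ 0 := fun h => hv (by
    ext i
    fin_cases i
    · simpa [hz] using congrArg Complex.re h
    · simpa [hz] using congrArg Complex.im h)
  refine ⟨z.arg, Complex.arg_mem_Ioc z, ‖z‖, norm_pos_iff.2 hz0, ?_⟩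
  ext i
  fin_cases i
  · simp [direction, Complex.norm_mul_cos_arg, hz]
  · simp [direction, Complex.norm_mul_sin_arg, hz]

variable (p : Seminorm ℝ Plane)

/-- The point of the unit circle of `p` in the direction with angle `t`. -/
noncomputable def circlePoint (t : ℝ) : Plane := (p (direction t))⁻¹ • direction t

theorem circlePoint_add_pi (t : ℝ) : circlePoint p (t + Real.pi) = -circlePoint p t := by
  simp [circlePoint, direction_add_pi]

theorem circlePoint_add_two_pi (t : ℝ) :
    circlePoint p (t + 2 * Real.pi) = circlePoint p t := by
  rw [two_mul, ← add_assoc, circlePoint_add_pi, circlePoint_add_pi, neg_neg]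

/-- The angle of the farthest point of the unit circle, in the positive direction, that has distance
at most one from the point with angle `t`. -/
noncomputable def farthest (t : ℝ) : ℝ :=
  sSup {u | u ∈ Set.Icc t (t + Real.pi) ∧ p (circlePoint p u - circlePoint p t) ≤ 1}

variable {p}

theorem map_circlePoint (hp : ∀ x : Plane, x ≠ 0 → 0 < p x) (t : ℝ) :
    p (circlePoint p t) = 1 := by
  have h := hp _ (direction_ne_zero t)
  rw [circlePoint, p.map_smul_of_nonneg (inv_nonneg.2 h.le), inv_mul_cancel₀ h.ne']

theorem continuous_circlePoint (hp : ∀ x : Plane, x ≠ 0 → 0 < p x) (hc : Continuous p) :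
    Continuous (circlePoint p) :=
  ((hc.comp continuous_direction).inv₀ fun t => (hp _ (direction_ne_zero t)).ne').smul
    continuous_direction

theorem circlePoint_eq_of_smul_direction (hp : ∀ x : Plane, x ≠ 0 → 0 < p x) {v : Plane} {r t : ℝ}
    (hr : 0 < r) (h : v = r • direction t) : circlePoint p t = (p v)⁻¹ • v := by
  have := (hp _ (direction_ne_zero t)).ne'
  rw [h, p.map_smul_of_nonneg hr.le, circlePoint, smul_smul]
  congr 1
  field_simp

/-- A point of the unit circle is a positive combination of two points enclosing it. -/
theorem exists_circlePoint_combination (hp : ∀ x : Plane, x ≠ 0 → 0 < p x) {s t u : ℝ}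
    (hst : s < t) (htu : t < u) (hus : u < s + Real.pi) :
    ∃ a b : ℝ, 0 < a ∧ 0 < b ∧ circlePoint p t = a • circlePoint p s + b • circlePoint p u := by
  have h1 : 0 < Real.sin (u - s) := Real.sin_pos_of_pos_of_lt_pi (by linarith) (by linarith)
  have h2 : 0 < Real.sin (u - t) := Real.sin_pos_of_pos_of_lt_pi (by linarith) (by linarith)
  have h3 : 0 < Real.sin (t - s) := Real.sin_pos_of_pos_of_lt_pi (by linarith) (by linarith)
  have hs := hp _ (direction_ne_zero s)
  have ht := hp _ (direction_ne_zero t)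
  have hu := hp _ (direction_ne_zero u)
  refine ⟨Real.sin (u - t) * p (direction s) / (Real.sin (u - s) * p (direction t)),
    Real.sin (t - s) * p (direction u) / (Real.sin (u - s) * p (direction t)),
    by positivity, by positivity, ?_⟩
  have h := direction_combination s t u
  have e : direction t = (Real.sin (u - s))⁻¹ •
      (Real.sin (u - t) • direction s + Real.sin (t - s) • direction u) := by
    rw [← h, smul_smul, inv_mul_cancel₀ h1.ne', one_smul]
  have e' : circlePoint p t = (p (direction t))⁻¹ • (Real.sin (u - s))⁻¹ •
      (Real.sin (u - t) • direction s + Real.sin (t - s) • direction u) := by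
    rw [← e, circlePoint]
  rw [e', circlePoint, circlePoint]
  simp only [smul_add, smul_smul]
  congr 2 <;> field_simp

theorem map_circlePoint_sub_le_two (hp : ∀ x : Plane, x ≠ 0 → 0 < p x) (s t : ℝ) :
    p (circlePoint p s - circlePoint p t) ≤ 2 := by
  have := map_sub_le_add p (circlePoint p s) (circlePoint p t)
  rw [map_circlePoint hp, map_circlePoint hp] at this
  linarith

theorem map_circlePoint_add_pi_sub (hp : ∀ x : Plane, x ≠ 0 → 0 < p x) (t : ℝ) :
    p (circlePoint p (t + Real.pi) - circlePoint p t) = 2 := by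
  have : circlePoint p (t + Real.pi) - circlePoint p t = -((2 : ℝ) • circlePoint p t) := by
    rw [circlePoint_add_pi]; module
  rw [this, map_neg_eq_map, p.map_smul_of_nonneg zero_le_two, map_circlePoint hp, mul_one]

theorem circlePoint_sub_le_right (hp : ∀ x : Plane, x ≠ 0 → 0 < p x) {s t u : ℝ}
    (hst : s ≤ t) (htu : t ≤ u) (hus : u ≤ s + Real.pi) :
    p (circlePoint p t - circlePoint p s) ≤ p (circlePoint p u - circlePoint p s) := by
  rcases hst.eq_or_lt with rfl | hst
  · simp
  rcases htu.eq_or_lt with rfl | htu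
  · exact le_rfl
  rcases hus.eq_or_lt with rfl | hus
  · rw [map_circlePoint_add_pi_sub hp]
    exact map_circlePoint_sub_le_two hp _ _
  obtain ⟨a, b, ha, hb, h⟩ := exists_circlePoint_combination hp hst htu hus
  exact p.sub_le_sub_of_mem_cone (map_circlePoint hp s) (map_circlePoint hp t)
    (map_circlePoint hp u) ha.le hb.le h

theorem circlePoint_sub_le_left (hp : ∀ x : Plane, x ≠ 0 → 0 < p x) {s t u : ℝ}
    (hst : s ≤ t) (htu : t ≤ u) (hus : u ≤ s + Real.pi) :
    p (circlePoint p u - circlePoint p t) ≤ p (circlePoint p u - circlePoint p s) := by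
  rcases hst.eq_or_lt with rfl | hst
  · simp
  rcases htu.eq_or_lt with rfl | htu
  · simp
  rcases hus.eq_or_lt with rfl | hus
  · rw [map_circlePoint_add_pi_sub hp]
    exact map_circlePoint_sub_le_two hp _ _
  obtain ⟨a, b, ha, hb, h⟩ := exists_circlePoint_combination hp hst htu hus
  rw [map_sub_rev p _ (circlePoint p t), map_sub_rev p _ (circlePoint p s)]
  exact p.sub_le_sub_of_mem_cone (map_circlePoint hp u) (map_circlePoint hp t)
    (map_circlePoint hp s) hb.le ha.le (by rw [h, add_comm])

theorem isGreatest_farthest (hp : ∀ x : Plane, x ≠ 0 → 0 < p x) (hc : Continuous p) (t : ℝ) :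
    IsGreatest {u | u ∈ Set.Icc t (t + Real.pi) ∧ p (circlePoint p u - circlePoint p t) ≤ 1}
      (farthest p t) := by
  have hcomp : IsCompact
      {u | u ∈ Set.Icc t (t + Real.pi) ∧ p (circlePoint p u - circlePoint p t) ≤ 1} :=
    isCompact_Icc.inter_right (isClosed_le
      (hc.comp ((continuous_circlePoint hp hc).sub continuous_const)) continuous_const)
  exact hcomp.isGreatest_sSup
    ⟨t, ⟨le_rfl, by linarith [Real.pi_pos]⟩, by simp⟩

theorem map_circlePoint_farthest_sub_le (hp : ∀ x : Plane, x ≠ 0 → 0 < p x) (hc : Continuous p)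
    (t : ℝ) : p (circlePoint p (farthest p t) - circlePoint p t) ≤ 1 :=
  (isGreatest_farthest hp hc t).1.2

theorem farthest_lt_add_pi (hp : ∀ x : Plane, x ≠ 0 → 0 < p x) (hc : Continuous p) (t : ℝ) :
    farthest p t < t + Real.pi := by
  refine lt_of_le_of_ne (isGreatest_farthest hp hc t).1.1.2 fun h => ?_
  have h1 := map_circlePoint_farthest_sub_le hp hc t
  rw [h, map_circlePoint_add_pi_sub hp] at h1
  norm_num at h1

theorem lt_farthest (hp : ∀ x : Plane, x ≠ 0 → 0 < p x) (hc : Continuous p) (t : ℝ) :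
    t < farthest p t := by
  have h1 : ∀ᶠ u in nhds t, p (circlePoint p u - circlePoint p t) < 1 := by
    refine ContinuousAt.eventually_lt
      (hc.comp ((continuous_circlePoint hp hc).sub continuous_const)).continuousAt
      continuousAt_const ?_
    simp
  have h2 : ∀ᶠ u in nhdsWithin t (Set.Ioi t), u ∈ Set.Ioc t (t + Real.pi) :=
    Ioc_mem_nhdsGT (by linarith [Real.pi_pos])
  obtain ⟨u, hu1, hu2⟩ := ((h1.filter_mono nhdsWithin_le_nhds).and h2).exists
  exact hu2.1.trans_le ((isGreatest_farthest hp hc t).2 ⟨⟨hu2.1.le, hu2.2⟩, hu1.le⟩)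

theorem map_circlePoint_sub_le_one (hp : ∀ x : Plane, x ≠ 0 → 0 < p x) (hc : Continuous p)
    {s t : ℝ} (hst : s ≤ t) (ht : t ≤ farthest p s) :
    p (circlePoint p t - circlePoint p s) ≤ 1 :=
  (circlePoint_sub_le_right hp hst ht (farthest_lt_add_pi hp hc s).le).trans
    (map_circlePoint_farthest_sub_le hp hc s)

theorem farthest_lt_of_one_lt (hp : ∀ x : Plane, x ≠ 0 → 0 < p x) (hc : Continuous p)
    {s t : ℝ} (hst : s ≤ t) (h : 1 < p (circlePoint p t - circlePoint p s)) :
    farthest p s < t := by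
  by_contra! ht
  exact h.not_ge (map_circlePoint_sub_le_one hp hc hst ht)

/-- A close pair would be seen by `farthest` from `s` if the arc from `s` to `t` is at most π, and
otherwise from `t` along the complementary arc to `s + 2π`. -/
theorem one_lt_of_farthest_lt (hp : ∀ x : Plane, x ≠ 0 → 0 < p x) (hc : Continuous p)
    {s t : ℝ} (h : farthest p s < t) (ht : farthest p t < s + 2 * Real.pi) :
    1 < p (circlePoint p t - circlePoint p s) := by
  have hst := (lt_farthest hp hc s).trans h
  have hts := (lt_farthest hp hc t).trans ht
  by_contra! hle
  rcases le_total t (s + Real.pi) with h' | h'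
  · exact h.not_ge ((isGreatest_farthest hp hc s).2 ⟨⟨hst.le, h'⟩, hle⟩)
  · refine ht.not_ge ((isGreatest_farthest hp hc t).2 ⟨⟨hts.le, by linarith⟩, ?_⟩)
    rwa [circlePoint_add_two_pi, map_sub_rev]

/-- With distance less than 1 one could move on a little, since the antipode, at distance 2, is not
yet reached. -/
theorem map_circlePoint_farthest_sub (hp : ∀ x : Plane, x ≠ 0 → 0 < p x) (hc : Continuous p)
    (t : ℝ) : p (circlePoint p (farthest p t) - circlePoint p t) = 1 := by
  refine (map_circlePoint_farthest_sub_le hp hc t).eq_or_lt.resolve_right fun hlt => ?_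
  have h1 : ∀ᶠ u in nhds (farthest p t), p (circlePoint p u - circlePoint p t) < 1 :=
    ContinuousAt.eventually_lt
      (hc.comp ((continuous_circlePoint hp hc).sub continuous_const)).continuousAt
      continuousAt_const hlt
  have h2 : ∀ᶠ u in nhdsWithin (farthest p t) (Set.Ioi (farthest p t)),
      u ∈ Set.Ioc (farthest p t) (t + Real.pi) :=
    Ioc_mem_nhdsGT (farthest_lt_add_pi hp hc t)
  obtain ⟨u, hu1, hu2⟩ := ((h1.filter_mono nhdsWithin_le_nhds).and h2).exists
  exact hu2.1.not_ge ((isGreatest_farthest hp hc t).2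
    ⟨⟨(lt_farthest hp hc t).le.trans hu2.1.le, hu2.2⟩, hu1.le⟩)

theorem farthest_mono (hp : ∀ x : Plane, x ≠ 0 → 0 < p x) (hc : Continuous p) :
    Monotone (farthest p) := by
  intro s t hst
  rcases le_total (farthest p s) t with h | h
  · exact h.trans (lt_farthest hp hc t).le
  · have hpi := farthest_lt_add_pi hp hc s
    exact (isGreatest_farthest hp hc t).2 ⟨⟨h, by linarith⟩,
      (circlePoint_sub_le_left hp hst h hpi.le).trans (map_circlePoint_farthest_sub_le hp hc s)⟩

/-- `farthest` is continuous from the right. -/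
theorem exists_farthest_lt (hp : ∀ x : Plane, x ≠ 0 → 0 < p x) (hc : Continuous p) {t b : ℝ}
    (h : farthest p t < b) : ∃ u, t < u ∧ farthest p u < b := by
  wlog hb : b ≤ t + Real.pi generalizing b
  · obtain ⟨u, hu, hub⟩ := this (farthest_lt_add_pi hp hc t) le_rfl
    exact ⟨u, hu, hub.trans (not_le.1 hb)⟩
  have hlt : 1 < p (circlePoint p b - circlePoint p t) := by
    by_contra! hle
    exact h.not_ge ((isGreatest_farthest hp hc t).2
      ⟨⟨((lt_farthest hp hc t).trans h).le, hb⟩, hle⟩)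
  have h1 : ∀ᶠ u in nhds t, 1 < p (circlePoint p b - circlePoint p u) :=
    ContinuousAt.eventually_lt continuousAt_const
      (hc.comp (continuous_const.sub (continuous_circlePoint hp hc))).continuousAt hlt
  have h2 : ∀ᶠ u in nhdsWithin t (Set.Ioi t), u ∈ Set.Ioc t b :=
    Ioc_mem_nhdsGT ((lt_farthest hp hc t).trans h)
  obtain ⟨u, hu1, hu2⟩ := ((h1.filter_mono nhdsWithin_le_nhds).and h2).exists
  exact ⟨u, hu2.1, farthest_lt_of_one_lt hp hc hu2.2 hu1⟩

theorem exists_iterate_farthest_lt (hp : ∀ x : Plane, x ≠ 0 → 0 < p x) (hc : Continuous p)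
    (n : ℕ) {t b : ℝ} (h : (farthest p)^[n] t < b) : ∃ u, t < u ∧ (farthest p)^[n] u < b := by
  induction n generalizing t with
  | zero => exact exists_between h
  | succ n ih =>
    rw [Function.iterate_succ_apply] at h
    obtain ⟨y, hy, hyb⟩ := ih h
    obtain ⟨u, hu, huy⟩ := exists_farthest_lt hp hc hy
    exact ⟨u, hu, ((farthest_mono hp hc).iterate n huy.le).trans_lt hyb⟩

/-- Values of `farthest` are accumulated from the right by values of `farthest`. -/
theorem exists_farthest_mem_Ioo (hp : ∀ x : Plane, x ≠ 0 → 0 < p x) (hc : Continuous p) {t b : ℝ}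
    (h : farthest p t < b) : ∃ w, farthest p w ∈ Set.Ioo (farthest p t) b := by
  by_contra! hno
  have hjump : ∀ w, farthest p t < farthest p w → b ≤ farthest p w := fun w hw => by
    by_contra! hb
    exact hno w ⟨hw, hb⟩
  -- If the values skip an interval, then at `s = sSup S` the map jumps to at least `b`, by right
  -- continuity, after being constant on `[t, s)`. The points at `t`, `s`, `farthest p t`, `farthest
  -- p s` then form the forbidden configuration.
  set S : Set ℝ := {w | farthest p w ≤ farthest p t} with hS
  have hbdd : BddAbove S := ⟨farthest p t, fun w hw => (lt_farthest hp hc w).le.trans hw⟩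
  have htS : t ∈ S := le_refl (farthest p t)
  set s : ℝ := sSup S with hs
  have hgt : ∀ w, s < w → b ≤ farthest p w := fun w hw =>
    hjump w (not_le.1 fun hle => (le_csSup hbdd hle).not_gt hw)
  have hsb : b ≤ farthest p s := by
    by_contra! hlt
    obtain ⟨u, hu, hub⟩ := exists_farthest_lt hp hc hlt
    exact (hgt u hu).not_gt hub
  have hts : t < s := lt_of_le_of_ne (le_csSup hbdd htS) fun e => by
    rw [← e] at hsb; exact hsb.not_gt h
  have heq : ∀ w, t ≤ w → w < s → farthest p w = farthest p t := fun w htw hws => by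
    obtain ⟨v, hv, hwv⟩ := exists_lt_of_lt_csSup ⟨t, htS⟩ hws
    exact le_antisymm ((farthest_mono hp hc hwv.le).trans hv) (farthest_mono hp hc htw)
  have hdist : p (circlePoint p (farthest p t) - circlePoint p s) = 1 := by
    have hcont : Continuous fun w => p (circlePoint p (farthest p t) - circlePoint p w) :=
      hc.comp (continuous_const.sub (continuous_circlePoint hp hc))
    have hlim := hcont.continuousAt (x := s)
    have hev : ∀ᶠ w in nhdsWithin s (Set.Iio s),
        p (circlePoint p (farthest p t) - circlePoint p w) = 1 := by
      filter_upwards [Ico_mem_nhdsLT hts] with w hw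
      rw [← heq w hw.1 hw.2, map_circlePoint_farthest_sub hp hc]
    exact tendsto_nhds_unique (hlim.tendsto.mono_left nhdsWithin_le_nhds)
      (tendsto_const_nhds.congr' (hev.mono fun w hw => hw.symm))
  have hsy : s < farthest p t := by
    refine lt_of_le_of_ne (csSup_le ⟨t, htS⟩ fun w hw => (lt_farthest hp hc w).le.trans hw) ?_
    intro e
    rw [e] at hdist
    simp at hdist
  have hpi := farthest_lt_add_pi hp hc t
  have hpi' := farthest_lt_add_pi hp hc s
  obtain ⟨l, m, hl, hm, h1⟩ := exists_circlePoint_combination hp hts hsy hpi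
  obtain ⟨l', m', hl', hm', h2⟩ := exists_circlePoint_combination hp hsy (h.trans_le hsb) hpi'
  exact p.false_of_unit_configuration (map_circlePoint hp t) (map_circlePoint hp s)
    (map_circlePoint hp _) (map_circlePoint_farthest_sub hp hc t) hdist
    (map_circlePoint_farthest_sub_le hp hc s) hl hm hl' hm' h1 h2

/-- If `n + 1` steps of `farthest` stay below `b`, then there is a chain of `2 * n + 1` angles in
which exactly consecutive points are close. -/
theorem exists_farthest_chain (hp : ∀ x : Plane, x ≠ 0 → 0 < p x) (hc : Continuous p) (n : ℕ)
    {t b : ℝ} (h : (farthest p)^[n + 1] t < b) :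
    ∃ f : ℕ → ℝ, f 0 = t ∧ farthest p (f (2 * n)) < b ∧
      (∀ k, k < 2 * n → f k < f (k + 1) ∧ f (k + 1) ≤ farthest p (f k)) ∧
      ∀ k, k + 1 < 2 * n → farthest p (f k) < f (k + 2) := by
  induction n generalizing t with
  | zero => exact ⟨fun _ => t, rfl, h, by simp, by simp⟩
  | succ n ih =>
    rw [Function.iterate_succ_apply] at h
    obtain ⟨v, hv, hvb⟩ := exists_iterate_farthest_lt hp hc (n + 1) h
    -- The bound by `v` keeps the remaining iterates below `b`; the bound by the second iterate of
    -- `t` gives `w ≤ farthest p t`.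
    obtain ⟨w, hw1, hw2⟩ := exists_farthest_mem_Ioo hp hc
      (lt_min hv (lt_farthest hp hc (farthest p t)))
    have htw : t < w := lt_of_not_ge fun hle => hw1.not_ge (farthest_mono hp hc hle)
    have hwt : w ≤ farthest p t := le_of_not_gt fun hlt =>
      (hw2.trans_le (min_le_right _ _)).not_ge (farthest_mono hp hc hlt.le)
    obtain ⟨f, hf0, hfb, hf1, hf2⟩ := ih (t := farthest p w)
      (((farthest_mono hp hc).iterate (n + 1) (hw2.trans_le (min_le_left _ _)).le).trans_lt hvb)
    refine ⟨fun | 0 => t | 1 => w | k + 2 => f k, rfl, hfb, ?_, ?_⟩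
    · rintro (_ | _ | k) hk
      · exact ⟨htw, hwt⟩
      · exact ⟨by simpa [hf0] using lt_farthest hp hc w, by simp [hf0]⟩
      · exact hf1 k (by omega)
    · rintro (_ | _ | k) hk
      · simpa [hf0] using hw1
      · have := (hf1 0 (by omega)).1
        simpa [hf0] using this
      · exact hf2 k (by omega)

end Circle

/-! ### Kissing paths and their chains -/

section Chain

/-- `x 0, …, x M` is an induced path of the unit distance graph of `p` inside the unit ball, whose
two ends, and only they, lie on the unit circle. -/
structure IsKissingPath (p : Seminorm ℝ Plane) (x : ℕ → Plane) (M : ℕ) : Prop where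
  first : p (x 0) = 1
  last : p (x M) = 1
  inner : ∀ i, 0 < i → i < M → p (x i) < 1
  ne_zero : ∀ i, i ≤ M → x i ≠ 0
  near : ∀ i, i < M → p (x i - x (i + 1)) ≤ 1
  far : ∀ i j, i + 2 ≤ j → j ≤ M → 1 < p (x i - x j)

variable {p : Seminorm ℝ Plane}

/-- For `a ≤ b`, write `a • u - b • v = a • (u - v) + (b - a) • (-v)`. Thus shrinking points of the
circle preserves closeness. -/
theorem Seminorm.smul_sub_smul_le_one {u v : Plane} (hu : p u = 1) (hv : p v = 1)
    (huv : p (u - v) ≤ 1) {a b : ℝ} (ha : 0 ≤ a) (hb : 0 ≤ b) (ha1 : a ≤ 1) (hb1 : b ≤ 1) :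
    p (a • u - b • v) ≤ 1 := by
  rcases le_total a b with hab | hab
  · have := p.le_of_smul_eq (a := 1) (b := a) (c := b - a) (x := a • u - b • v) (y := u - v)
      (z := -v) zero_le_one ha (by linarith) (by module)
    rw [map_neg_eq_map, hv] at this
    nlinarith
  · have := p.le_of_smul_eq (a := 1) (b := b) (c := a - b) (x := a • u - b • v) (y := u - v)
      (z := u) zero_le_one hb (by linarith) (by module)
    rw [hu] at this
    nlinarith

/-- The refined chain of angles is an induced path on the circle, the bound `t + 2π` separating its
two ends. Pulling the inner points inwards by a common factor near 1 keeps the finitely many strict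
inequalities. -/
theorem exists_isKissingPath (hp : ∀ x : Plane, x ≠ 0 → 0 < p x) (hc : Continuous p) (n : ℕ)
    {t : ℝ} (h : (farthest p)^[n + 1] t < t + 2 * Real.pi) :
    ∃ x, IsKissingPath p x (2 * n) := by
  obtain ⟨f, hf0, hfb, hf1, hf2⟩ := exists_farthest_chain hp hc n h
  have hmono : ∀ i j, i ≤ j → j ≤ 2 * n → f i ≤ f j := by
    intro i j hij
    induction j, hij using Nat.le_induction with
    | base => exact fun _ => le_rfl
    | succ j _ ih => exact fun hj => (ih (by omega)).trans (hf1 j (by omega)).1.le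
  have hfar : ∀ i j, i + 2 ≤ j → j ≤ 2 * n →
      1 < p (circlePoint p (f i) - circlePoint p (f j)) := by
    intro i j hij hj
    rw [map_sub_rev]
    refine one_lt_of_farthest_lt hp hc ((hf2 i (by omega)).trans_le (hmono _ _ hij hj)) ?_
    have h0 := hmono 0 i (by omega) (by omega)
    have h1 := farthest_mono hp hc (hmono j (2 * n) hj le_rfl)
    linarith
  set s : ℝ → ℕ → ℝ := fun r i => if i = 0 ∨ i = 2 * n then 1 else r with hs
  have hscont : ∀ i, Continuous fun r => s r i := fun i => by
    simp only [hs]; split_ifs <;> fun_prop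
  have hs1 : ∀ i, s 1 i = 1 := fun i => by simp [hs]
  have hev : ∀ᶠ r in nhds (1 : ℝ), ∀ i ∈ Finset.range (2 * n + 1), ∀ j ∈ Finset.range (2 * n + 1),
      i + 2 ≤ j → 1 < p (s r i • circlePoint p (f i) - s r j • circlePoint p (f j)) := by
    rw [Filter.eventually_all_finset]
    intro i hi
    rw [Filter.eventually_all_finset]
    intro j hj
    by_cases hij : i + 2 ≤ j
    · have hcont : Continuous fun r =>
          p (s r i • circlePoint p (f i) - s r j • circlePoint p (f j)) :=
        hc.comp (((hscont i).smul continuous_const).sub ((hscont j).smul continuous_const))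
      refine (continuousAt_const.eventually_lt hcont.continuousAt ?_).mono fun r hr _ => hr
      rw [hs1, hs1, one_smul, one_smul]
      exact hfar i j hij (by simp at hj; omega)
    · exact Filter.Eventually.of_forall fun r h' => absurd h' hij
  obtain ⟨r, hr, hr0, hr1⟩ := ((hev.filter_mono nhdsWithin_le_nhds).and
    (Ioo_mem_nhdsLT (zero_lt_one' ℝ))).exists
  have hspos : ∀ i, 0 < s r i := fun i => by simp only [hs]; split_ifs <;> linarith
  have hsle : ∀ i, s r i ≤ 1 := fun i => by simp only [hs]; split_ifs <;> linarith
  have hnorm : ∀ i, p (s r i • circlePoint p (f i)) = s r i := fun i => by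
    rw [p.map_smul_of_nonneg (hspos i).le, map_circlePoint hp, mul_one]
  refine ⟨fun i => s r i • circlePoint p (f i), ⟨?_, ?_, ?_, ?_, ?_, ?_⟩⟩
  · rw [hnorm]; simp [hs]
  · rw [hnorm]; simp [hs]
  · intro i hi0 hi
    rw [hnorm]
    simp only [hs]
    rwa [if_neg (by omega)]
  · intro i _ h0
    have := hnorm i
    rw [h0, map_zero] at this
    exact (hspos i).ne this
  · intro i hi
    refine Seminorm.smul_sub_smul_le_one (map_circlePoint hp _) (map_circlePoint hp _) ?_
      (hspos _).le (hspos _).le (hsle _) (hsle _)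
    rw [map_sub_rev]
    exact map_circlePoint_sub_le_one hp hc (hf1 i hi).1.le (hf1 i hi).2
  · intro i j hij hj
    exact hr i (Finset.mem_range.2 (by omega)) j (Finset.mem_range.2 (by omega)) hij

theorem IsKissingPath.le_one {x : ℕ → Plane} {M : ℕ} (h : IsKissingPath p x M) {i : ℕ}
    (hi : i ≤ M) : p (x i) ≤ 1 := by
  rcases Nat.eq_zero_or_pos i with rfl | h0
  · exact h.first.le
  rcases hi.eq_or_lt with rfl | hi
  · exact h.last.le
  · exact (h.inner i h0 hi).le

/-- Consecutive vertices are told apart by a third vertex near one and far from the other, which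
exists as `2 ≤ M`. -/
theorem IsKissingPath.ne {x : ℕ → Plane} {M : ℕ} (h : IsKissingPath p x M) (hM : 2 ≤ M) {i j : ℕ}
    (hij : i < j) (hj : j ≤ M) : x i ≠ x j := by
  intro e
  rcases Nat.lt_or_ge (i + 1) j with hlt | hge
  · have := h.far i j hlt hj
    rw [e, sub_self, map_zero] at this
    linarith
  obtain rfl : j = i + 1 := by omega
  rcases Nat.lt_or_ge (i + 1) M with hlt | hge
  · have h1 := h.far i (i + 2) le_rfl hlt
    have h2 := h.near (i + 1) hlt
    rw [e] at h1
    linarith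
  · obtain ⟨k, rfl⟩ : ∃ k, i = k + 1 := ⟨i - 1, by omega⟩
    have h1 := h.far k (k + 2) le_rfl hj
    have h2 := h.near k (by omega)
    rw [e] at h2
    linarith

/-- This compares a block around 0 with a reflected block around `3 • e`. The norm is at least `3 -
p u - p v`, which suffices if `u` or `v` is interior; the other cases use `1 < p (e - e')`. -/
theorem Seminorm.one_lt_three_smul_sub_sub {e e' u v : Plane} (he : p e = 1) (he' : p e' = 1)
    (hee : 1 < p (e - e')) (hu : u = e ∨ u = e' ∨ p u < 1) (hv : v = e ∨ v = e' ∨ p v < 1)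
    (huv : ¬(u = e ∧ v = e)) : 1 < p ((3 : ℝ) • e - u - v) := by
  have hu1 : p u ≤ 1 := by rcases hu with rfl | rfl | h <;> linarith
  have hv1 : p v ≤ 1 := by rcases hv with rfl | rfl | h <;> linarith
  have h3 : 3 ≤ p ((3 : ℝ) • e - u - v) + p u + p v := by
    have h1 := p.le_of_smul_eq (a := 3) (b := 1) (c := 1) (x := e) (y := (3 : ℝ) • e - u - v)
      (z := u + v) (by norm_num) zero_le_one zero_le_one (by module)
    have h2 := map_add_le_add p u v
    linarith
  have h12 : 1 < p ((3 : ℝ) • e - e - e') := by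
    have := p.le_of_smul_eq (a := 2) (b := 1) (c := 1) (x := e - e') (y := (3 : ℝ) • e - e - e')
      (z := -e') (by norm_num) zero_le_one zero_le_one (by module)
    rw [map_neg_eq_map] at this
    linarith
  rcases hu with rfl | rfl | h
  · rcases hv with rfl | rfl | h'
    · exact absurd ⟨rfl, rfl⟩ huv
    · exact h12
    · linarith
  · rcases hv with rfl | rfl | h'
    · rwa [sub_right_comm]
    · have := p.le_of_smul_eq (a := 3) (b := 1) (c := 1) (x := e - v)
        (y := (3 : ℝ) • e - v - v) (z := -v) (by norm_num) zero_le_one zero_le_one (by module)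
      rw [map_neg_eq_map] at this
      linarith
    · linarith
  · linarith

/-- Three times these vectors are the centre differences between blocks of opposite parity; the
excluded `k` give the link vectors `b` and `a`, of norm 1. -/
theorem Seminorm.one_lt_add_smul_sub {a b : Plane} (ha : p a = 1) (hb : p b = 1)
    (hab : 1 < p (b - a)) {k : ℤ} (h0 : k ≠ 0) (h1 : k ≠ -1) :
    1 < p (b + (k : ℝ) • (b - a)) := by
  rcases lt_or_gt_of_ne h0 with hk | hk
  · have hk2 : (k : ℝ) ≤ -2 := by exact_mod_cast (by omega : k ≤ -2)
    have := p.le_of_smul_eq (a := -k) (b := 1) (c := 1) (x := b - a)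
      (y := -(b + (k : ℝ) • (b - a))) (z := b) (by linarith) zero_le_one zero_le_one (by module)
    rw [map_neg_eq_map, hb] at this
    nlinarith
  · have hk2 : (1 : ℝ) ≤ k := by exact_mod_cast (by omega : 1 ≤ k)
    have := p.le_of_smul_eq (a := k + 1) (b := 1) (c := 1) (x := b - a)
      (y := b + (k : ℝ) • (b - a)) (z := -a) (by linarith) zero_le_one zero_le_one (by module)
    rw [map_neg_eq_map, ha] at this
    nlinarith

/-- The centre of block number `j` of the chain with link vectors `a` and `b`. -/
noncomputable def chainCenter (a b : Plane) (j : ℕ) : Plane :=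
  (if Even j then 0 else (3 : ℝ) • b) + (3 * ((j / 2 : ℕ) : ℝ)) • (b - a)

/-- Vertex number `i` of block number `j` of the chain: the blocks are translates of the path `x`
and of its reversed point reflection, alternately. -/
noncomputable def chainVertex (x : ℕ → Plane) (M j i : ℕ) : Plane :=
  chainCenter (x 0) (x M) j + if Even j then x i else -x (M - i)

theorem chainCenter_even (a b : Plane) (k : ℕ) :
    chainCenter a b (2 * k) = (3 * (k : ℝ)) • (b - a) := by
  simp [chainCenter]

theorem chainCenter_odd (a b : Plane) (k : ℕ) :
    chainCenter a b (2 * k + 1) = (3 : ℝ) • b + (3 * (k : ℝ)) • (b - a) := by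
  have : (2 * k + 1) / 2 = k := by omega
  simp [chainCenter, this]

theorem chainVertex_even (x : ℕ → Plane) (M k i : ℕ) :
    chainVertex x M (2 * k) i = (3 * (k : ℝ)) • (x M - x 0) + x i := by
  rw [chainVertex, chainCenter_even, if_pos (even_two_mul k)]

theorem chainVertex_odd (x : ℕ → Plane) (M k i : ℕ) :
    chainVertex x M (2 * k + 1) i =
      (3 : ℝ) • x M + (3 * (k : ℝ)) • (x M - x 0) - x (M - i) := by
  rw [chainVertex, chainCenter_odd, if_neg (by simp), ← sub_eq_add_neg]

/-! ### Distances within and between the blocks of the chain. -/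

variable {x : ℕ → Plane} {M : ℕ}

theorem IsKissingPath.eq_or_lt (h : IsKissingPath p x M) {i : ℕ} (hi : i ≤ M) :
    x i = x 0 ∨ x i = x M ∨ p (x i) < 1 := by
  rcases Nat.eq_zero_or_pos i with rfl | h0
  · exact Or.inl rfl
  rcases hi.eq_or_lt with rfl | hi
  · exact Or.inr (Or.inl rfl)
  · exact Or.inr (Or.inr (h.inner i h0 hi))

theorem IsKissingPath.one_lt_ends (h : IsKissingPath p x M) (hM : 2 ≤ M) :
    1 < p (x M - x 0) := by
  rw [map_sub_rev]
  exact h.far 0 M (by omega) le_rfl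

theorem IsKissingPath.one_lt_even (h : IsKissingPath p x M) (hM : 2 ≤ M) {i j : ℕ} (hi : i ≤ M)
    (hj : j ≤ M) {k : ℤ} (hk : k ≠ 0) :
    1 < p ((3 * (k : ℝ)) • (x M - x 0) + x i - x j) := by
  have hd := h.one_lt_ends hM
  have hi := h.le_one hi
  have hj := h.le_one hj
  have h1 : 1 ≤ |(k : ℝ)| := by exact_mod_cast Int.one_le_abs hk
  have h2 : p ((3 * (k : ℝ)) • (x M - x 0)) = 3 * |(k : ℝ)| * p (x M - x 0) := by
    rw [map_smul_eq_mul, norm_mul, Real.norm_eq_abs, Real.norm_eq_abs, abs_of_pos three_pos]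
  have h3 := map_sub_le_add p ((3 * (k : ℝ)) • (x M - x 0) + x i - x j) (x i - x j)
  have h4 := map_sub_le_add p (x i) (x j)
  rw [add_sub_assoc, add_sub_cancel_right, h2] at h3
  rw [add_sub_assoc]
  nlinarith

/-- The two excluded index pairs are exactly the links between consecutive blocks, along `x M` for
`k = 0` and along `x 0` for `k = -1`. -/
theorem IsKissingPath.one_lt_odd (h : IsKissingPath p x M) (hM : 2 ≤ M) {i j : ℕ} (hi : i ≤ M)
    (hj : j ≤ M) {k : ℤ} (h0 : k = 0 → ¬(i = M ∧ j = M)) (h1 : k = -1 → ¬(i = 0 ∧ j = 0)) :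
    1 < p ((3 : ℝ) • (x M + (k : ℝ) • (x M - x 0)) - x i - x j) := by
  have hd := h.one_lt_ends hM
  have hinj : ∀ i j, i ≤ M → j ≤ M → x i = x j → i = j := fun i j hi hj e => by
    rcases Nat.lt_trichotomy i j with hlt | rfl | hlt
    · exact absurd e (h.ne hM hlt hj)
    · rfl
    · exact absurd e.symm (h.ne hM hlt hi)
  have hi' := h.eq_or_lt hi
  have hj' := h.eq_or_lt hj
  rcases eq_or_ne k 0 with rfl | hk0
  · simp only [Int.cast_zero, zero_smul, add_zero]
    exact Seminorm.one_lt_three_smul_sub_sub h.last h.first hd (by tauto) (by tauto)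
      fun e => h0 rfl ⟨hinj _ _ hi le_rfl e.1, hinj _ _ hj le_rfl e.2⟩
  rcases eq_or_ne k (-1) with rfl | hk1
  · have : x M + (((-1 : ℤ) : ℝ)) • (x M - x 0) = x 0 := by push_cast; module
    rw [this]
    exact Seminorm.one_lt_three_smul_sub_sub h.first h.last (by rwa [map_sub_rev]) hi' hj'
      fun e => h1 rfl ⟨hinj _ _ hi (by omega) e.1, hinj _ _ hj (by omega) e.2⟩
  · have h3 := Seminorm.one_lt_add_smul_sub h.first h.last hd hk0 hk1
    have h4 := p.le_of_smul_eq (a := 3) (b := 1) (c := 1) (x := x M + (k : ℝ) • (x M - x 0))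
      (y := (3 : ℝ) • (x M + (k : ℝ) • (x M - x 0)) - x i - x j) (z := x i + x j) (by norm_num)
      zero_le_one zero_le_one (by module)
    have h5 := map_add_le_add p (x i) (x j)
    have hi := h.le_one hi
    have hj := h.le_one hj
    linarith

theorem IsKissingPath.three_le_chainCenter (h : IsKissingPath p x M) (hM : 2 ≤ M) {j j' : ℕ}
    (hj : j < j') : 3 ≤ p (chainCenter (x 0) (x M) j - chainCenter (x 0) (x M) j') := by
  have hd := h.one_lt_ends hM
  have hodd : ∀ k : ℤ, 3 ≤ p ((3 : ℝ) • (x M + (k : ℝ) • (x M - x 0))) := by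
    intro k
    rw [p.map_smul_of_nonneg zero_le_three]
    rcases eq_or_ne k 0 with rfl | hk0
    · simp [h.last]
    rcases eq_or_ne k (-1) with rfl | hk1
    · have : x M + (((-1 : ℤ) : ℝ)) • (x M - x 0) = x 0 := by push_cast; module
      rw [this, h.first, mul_one]
    · linarith [Seminorm.one_lt_add_smul_sub h.first h.last hd hk0 hk1]
  have heven : ∀ k : ℤ, k ≠ 0 → 3 ≤ p ((3 * (k : ℝ)) • (x M - x 0)) := by
    intro k hk
    have h1 : 1 ≤ |(k : ℝ)| := by exact_mod_cast Int.one_le_abs hk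
    rw [map_smul_eq_mul, norm_mul, Real.norm_eq_abs, Real.norm_eq_abs, abs_of_pos three_pos]
    nlinarith
  obtain ⟨k, rfl | rfl⟩ := j.even_or_odd' <;> obtain ⟨l, rfl | rfl⟩ := j'.even_or_odd'
  · rw [chainCenter_even, chainCenter_even]
    convert heven ((k : ℤ) - l) (by omega) using 2
    push_cast; module
  · rw [chainCenter_even, chainCenter_odd, map_sub_rev]
    convert hodd ((l : ℤ) - k) using 2
    push_cast; module
  · rw [chainCenter_even, chainCenter_odd]
    convert hodd ((k : ℤ) - l) using 2
    push_cast; module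
  · rw [chainCenter_odd, chainCenter_odd]
    convert heven ((k : ℤ) - l) (by omega) using 2
    push_cast; module

theorem IsKissingPath.one_lt_chainVertex (h : IsKissingPath p x M) (hM : 2 ≤ M) {j j' i i' : ℕ}
    (hj : j < j') (hi : i ≤ M) (hi' : i' ≤ M) (hne : ¬(j' = j + 1 ∧ i = M ∧ i' = 0)) :
    1 < p (chainVertex x M j i - chainVertex x M j' i') := by
  obtain ⟨k, rfl | rfl⟩ := j.even_or_odd' <;> obtain ⟨l, rfl | rfl⟩ := j'.even_or_odd'
  · rw [chainVertex_even, chainVertex_even]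
    convert h.one_lt_even hM hi hi' (k := (k : ℤ) - l) (by omega) using 2
    push_cast; module
  · rw [chainVertex_even, chainVertex_odd, map_sub_rev]
    convert h.one_lt_odd hM hi (Nat.sub_le M i') (k := (l : ℤ) - k) (by omega) (by omega) using 2
    push_cast; module
  · rw [chainVertex_even, chainVertex_odd]
    convert h.one_lt_odd hM hi' (Nat.sub_le M i) (k := (k : ℤ) - l) (by omega) (by omega) using 2
    push_cast; module
  · rw [chainVertex_odd, chainVertex_odd]
    convert h.one_lt_even hM (Nat.sub_le M i') (Nat.sub_le M i) (k := (k : ℤ) - l) (by omega)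
      using 2
    push_cast; module

theorem IsKissingPath.chainVertex_link (h : IsKissingPath p x M) (j : ℕ) :
    p (chainVertex x M j M - chainVertex x M (j + 1) 0) = 1 := by
  obtain ⟨k, rfl | rfl⟩ := j.even_or_odd'
  · rw [chainVertex_even, chainVertex_odd, map_sub_rev, ← h.last]
    congr 1
    rw [Nat.sub_zero]
    module
  · rw [show 2 * k + 1 + 1 = 2 * (k + 1) by ring, chainVertex_even, chainVertex_odd, ← h.first]
    congr 1
    rw [Nat.sub_self]
    push_cast
    module

theorem IsKissingPath.chainVertex_near (h : IsKissingPath p x M) (j : ℕ) {i : ℕ} (hi : i < M) :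
    p (chainVertex x M j i - chainVertex x M j (i + 1)) ≤ 1 := by
  rcases em (Even j) with hj | hj
  · simpa [chainVertex, hj] using h.near i hi
  · have := h.near (M - (i + 1)) (by omega)
    rw [show M - (i + 1) + 1 = M - i by omega] at this
    simpa [chainVertex, hj, add_comm, ← sub_eq_add_neg] using this

theorem IsKissingPath.chainVertex_far (h : IsKissingPath p x M) (j : ℕ) {i i' : ℕ}
    (hi : i + 2 ≤ i') (hi' : i' ≤ M) :
    1 < p (chainVertex x M j i - chainVertex x M j i') := by
  rcases em (Even j) with hj | hj
  · simpa [chainVertex, hj] using h.far i i' hi hi'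
  · have := h.far (M - i') (M - i) (by omega) (by omega)
    simpa [chainVertex, hj, add_comm, ← sub_eq_add_neg] using this

theorem IsKissingPath.chainVertex_ne (h : IsKissingPath p x M) (hM : 2 ≤ M) (j : ℕ) {i i' : ℕ}
    (hi : i < i') (hi' : i' ≤ M) : chainVertex x M j i ≠ chainVertex x M j i' := by
  rcases em (Even j) with hj | hj
  · simpa [chainVertex, hj] using h.ne hM hi hi'
  · have := h.ne hM (i := M - i') (j := M - i) (by omega) (by omega)
    simpa [chainVertex, hj] using this.symm

theorem IsKissingPath.chainCenter_sub_chainVertex (h : IsKissingPath p x M) (j : ℕ) {i : ℕ}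
    (hi : i ≤ M) : p (chainCenter (x 0) (x M) j - chainVertex x M j i) ≤ 1 := by
  rcases em (Even j) with hj | hj
  · simpa [chainVertex, hj] using h.le_one hi
  · simpa [chainVertex, hj] using h.le_one (Nat.sub_le M i)

theorem IsKissingPath.chainCenter_ne_chainVertex (h : IsKissingPath p x M) (hM : 2 ≤ M) (j : ℕ)
    {i j' : ℕ} (hi : i ≤ M) : chainCenter (x 0) (x M) j ≠ chainVertex x M j' i := by
  rcases eq_or_ne j j' with rfl | hne
  · rcases em (Even j) with hj | hj
    · simpa [chainVertex, hj] using h.ne_zero i hi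
    · simpa [chainVertex, hj] using h.ne_zero _ (Nat.sub_le M i)
  · intro e
    have h1 := h.chainCenter_sub_chainVertex j' hi
    rw [← e] at h1
    rcases lt_or_gt_of_ne hne with hlt | hlt
    · have h2 := h.three_le_chainCenter hM hlt
      rw [map_sub_rev] at h2
      linarith
    · have h2 := h.three_le_chainCenter hM hlt
      linarith

end Chain

/-! ### From translates to a norm -/

section Translates

/-- Project radially and sort by angle: each step of `farthest` stops short of the next point, and
the last one short of the first point a full turn later. -/
theorem exists_iterate_farthest_lt_of_separated {p : Seminorm ℝ Plane}
    (hp : ∀ x : Plane, x ≠ 0 → 0 < p x) (hc : Continuous p) (P : Finset Plane)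
    (hcard : 1 < P.card) (h1 : ∀ v ∈ P, p v ≤ 1)
    (h2 : ∀ v ∈ P, ∀ w ∈ P, v ≠ w → 1 < p (v - w)) :
    ∃ t, (farthest p)^[P.card] t < t + 2 * Real.pi := by
  classical
  have hne : ∀ v ∈ P, v ≠ 0 := by
    rintro v hv rfl
    obtain ⟨w, hw, hwv⟩ := Finset.exists_mem_ne hcard 0
    have := h2 w hw 0 hv hwv
    rw [sub_zero] at this
    exact this.not_ge (h1 w hw)
  have hang : ∀ v, ∃ t, v ∈ P → t ∈ Set.Ioc (-Real.pi) Real.pi ∧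
      circlePoint p t = (p v)⁻¹ • v := by
    intro v
    by_cases hv : v ∈ P
    · obtain ⟨t, ht, r, hr, h⟩ := exists_eq_smul_direction (hne v hv)
      exact ⟨t, fun _ => ⟨ht, circlePoint_eq_of_smul_direction hp hr h⟩⟩
    · exact ⟨0, fun h => absurd h hv⟩
  choose ang hang using hang
  have hsep : ∀ v ∈ P, ∀ w ∈ P, v ≠ w →
      1 < p (circlePoint p (ang v) - circlePoint p (ang w)) := by
    intro v hv w hw hvw
    rw [(hang v hv).2, (hang w hw).2]
    exact p.one_lt_sub_normalize (h1 v hv) (h1 w hw) (hp v (hne v hv)) (hp w (hne w hw))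
      (h2 v hv w hw hvw)
  have hcardJ : (P.image ang).card = P.card :=
    Finset.card_image_of_injOn fun v hv w hw e => by
      by_contra hvw
      have := hsep v hv w hw hvw
      rw [e, sub_self, map_zero] at this
      linarith
  set f := (P.image ang).orderEmbOfFin hcardJ with hf
  have hfmem : ∀ i, ∃ v ∈ P, ang v = f i := fun i =>
    Finset.mem_image.1 (Finset.orderEmbOfFin_mem _ hcardJ i)
  have hfsep : ∀ i j, i ≠ j → 1 < p (circlePoint p (f i) - circlePoint p (f j)) := by
    intro i j hij
    obtain ⟨v, hv, hvi⟩ := hfmem i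
    obtain ⟨w, hw, hwj⟩ := hfmem j
    rw [← hvi, ← hwj]
    refine hsep v hv w hw ?_
    rintro rfl
    exact hij (f.injective (hvi.symm.trans hwj))
  have hiter : ∀ k (hk : k < P.card), (farthest p)^[k] (f ⟨0, by omega⟩) ≤ f ⟨k, hk⟩ := by
    intro k
    induction k with
    | zero => exact fun _ => le_rfl
    | succ k ih =>
      intro hk
      rw [Function.iterate_succ_apply']
      have hlt : (⟨k, by omega⟩ : Fin P.card) < ⟨k + 1, hk⟩ := by simp
      exact (farthest_mono hp hc (ih (by omega))).trans (farthest_lt_of_one_lt hp hc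
        (f.monotone hlt.le) (hfsep _ _ hlt.ne')).le
  refine ⟨f ⟨0, by omega⟩, ?_⟩
  obtain ⟨n, hn⟩ : ∃ n, P.card = n + 1 := ⟨P.card - 1, by omega⟩
  obtain ⟨v, hv, hvf⟩ := hfmem ⟨0, by omega⟩
  obtain ⟨w, hw, hwf⟩ := hfmem ⟨n, by omega⟩
  have hv' := (hang v hv).1
  have hw' := (hang w hw).1
  rw [hvf] at hv'
  rw [hwf] at hw'
  have e : ∀ y, (farthest p)^[P.card] y = farthest p ((farthest p)^[n] y) := fun y => by
    rw [hn, Function.iterate_succ_apply']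
  rw [e]
  refine (farthest_mono hp hc (hiter n (by omega))).trans_lt (farthest_lt_of_one_lt hp hc
    (by linarith [hv'.1, hw'.2]) ?_)
  rw [circlePoint_add_two_pi]
  refine hfsep _ _ fun h => ?_
  have := congrArg Fin.val h
  simp only at this
  omega

/-- The translate of `C` by `v`, as a vertex of the intersection graph. -/
def translateVertex (C : Set Plane) (v : Plane) : translates C := ⟨(fun x => v + x) '' C, v, rfl⟩

theorem exists_translateVertex_eq {C : Set Plane} (s : translates C) : ∃ v, translateVertex C v = s := by
  obtain ⟨_, v, rfl⟩ := s
  exact ⟨v, rfl⟩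

/-- Otherwise translation by `v - w` would map a maximizer over `C` of the inner product with `v -
w` to a point of `C` with a larger value. -/
theorem IsConvexObject.translateVertex_injective {C : Set Plane} (hC : IsConvexObject C) :
    Function.Injective (translateVertex C) := by
  intro v w h
  have hne : C.Nonempty := hC.interior_nonempty.mono interior_subset
  obtain ⟨c, hcC, hmax⟩ := hC.isCompact.exists_isMaxOn hne
    (f := fun x : Plane => inner ℝ (v - w) x) (by fun_prop)
  have h' : (fun x => v + x) '' C = (fun x => w + x) '' C := congrArg Subtype.val h
  have hmem : v + c ∈ (fun x => w + x) '' C := h' ▸ ⟨c, hcC, rfl⟩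
  obtain ⟨c', hc', e⟩ := hmem
  have e' : c' = (v - w) + c := by
    have : w + c' = v + c := e
    rw [sub_add_eq_add_sub, ← this, add_sub_cancel_left]
  have hle : inner ℝ (v - w) c' ≤ inner ℝ (v - w) c := hmax hc'
  rw [e', inner_add_right] at hle
  have h0 : inner ℝ (v - w) (v - w) = 0 := le_antisymm (by linarith) real_inner_self_nonneg
  exact sub_eq_zero.1 (inner_self_eq_zero.1 h0)

open Pointwise in
/-- Translates of `C` intersect iff their translation vectors have distance at most one in the norm
whose unit ball is the difference body of `C`. -/
theorem IsConvexObject.exists_seminorm {C : Set Plane} (hC : IsConvexObject C) :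
    ∃ p : Seminorm ℝ Plane, Continuous p ∧ (∀ x, x ≠ 0 → 0 < p x) ∧
      ∀ v w, ((translateVertex C v : Set Plane) ∩ translateVertex C w).Nonempty ↔ p (v - w) ≤ 1 := by
  have hconv : Convex ℝ (C - C) := hC.convex.sub hC.convex
  have hcomp : IsCompact (C - C) := by
    have : C - C = (fun z : Plane × Plane => z.1 - z.2) '' (C ×ˢ C) := by
      rw [Set.image_prod]; rfl
    rw [this]
    exact (hC.isCompact.prod hC.isCompact).image (by fun_prop)
  have hsymm : ∀ x ∈ C - C, -x ∈ C - C := by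
    rintro _ ⟨a, ha, b, hb, rfl⟩
    exact ⟨b, hb, a, ha, by simp⟩
  have hnhds : C - C ∈ nhds (0 : Plane) := by
    obtain ⟨c, hc⟩ := hC.interior_nonempty
    have : (fun x : Plane => x + c) ⁻¹' interior C ∈ nhds (0 : Plane) :=
      (isOpen_interior.preimage (by fun_prop)).mem_nhds (by simpa using hc)
    filter_upwards [this] with x hx
    exact ⟨x + c, interior_subset hx, c, interior_subset hc, by simp⟩
  have habs : Absorbent ℝ (C - C) := absorbent_nhds_zero hnhds
  have hbdd : Bornology.IsVonNBounded ℝ (C - C) :=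
    NormedSpace.isVonNBounded_of_isBounded ℝ hcomp.isBounded
  refine ⟨gaugeSeminorm ((balanced_iff_neg_mem hconv).2 fun x hx => hsymm x hx) hconv habs,
    continuous_gauge hconv hnhds, fun x hx => (gauge_pos habs hbdd).2 hx, fun v w => ?_⟩
  have hgauge : gauge (C - C) (v - w) ≤ 1 ↔ v - w ∈ C - C := by
    rw [gauge_le_one_iff_mem_closure hconv hnhds, hcomp.isClosed.closure_eq]
  refine Iff.trans ?_ hgauge.symm
  constructor
  · rintro ⟨x, ⟨a, ha, rfl⟩, ⟨b, hb, hab⟩⟩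
    refine ⟨b, hb, a, ha, ?_⟩
    have : w + b = v + a := hab
    rw [sub_eq_sub_iff_add_eq_add, add_comm b, this]
  · rintro ⟨a, ha, b, hb, hab⟩
    refine ⟨v + b, ⟨b, hb, rfl⟩, a, ha, ?_⟩
    have : a - b = v - w := hab
    rw [sub_eq_sub_iff_add_eq_add] at this
    rw [← this, add_comm]

theorem IsConvexObject.exists_isKissingPath {C : Set Plane} (hC : IsConvexObject C) {ζ : ℕ}
    (hζ : IsIndependentKissingNumber (translates C) ζ) :
    ∃ (p : Seminorm ℝ Plane) (n : ℕ) (x : ℕ → Plane), 0 < n ∧ ζ = n + 1 ∧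
      IsKissingPath p x (2 * n) ∧
      ∀ v w, (intersectionGraph (translates C)).Adj (translateVertex C v) (translateVertex C w) ↔
        v ≠ w ∧ p (v - w) ≤ 1 := by
  classical
  obtain ⟨p, hc, hp, hinter⟩ := hC.exists_seminorm
  have hdisj : ∀ v w, Disjoint (translateVertex C v : Set Plane) (translateVertex C w) ↔ 1 < p (v - w) :=
    fun v w => by rw [Set.disjoint_iff_inter_eq_empty, ← Set.not_nonempty_iff_eq_empty, hinter,
      not_le]
  have hinj := hC.translateVertex_injective
  -- Antipodal unit vectors already form an independent kissing configuration; this makes the path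
  -- nontrivial.
  have h2 : 2 ≤ ζ := by
    have he := map_circlePoint hp 0
    set e := circlePoint p 0
    have he0 : e ≠ 0 := fun h => by rw [h, map_zero] at he; norm_num at he
    have hee : p (e - -e) = 2 := by
      rw [sub_neg_eq_add, ← two_smul ℝ e, p.map_smul_of_nonneg zero_le_two, he, mul_one]
    have hne : e ≠ -e := fun h => by rw [← h, sub_self, map_zero] at hee; norm_num at hee
    refine hζ.2 ⟨translateVertex C 0, {translateVertex C e, translateVertex C (-e)}, ⟨?_, ?_, ?_⟩,
      Finset.card_pair (hinj.ne hne)⟩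
    · simp only [Finset.mem_insert, Finset.mem_singleton, hinj.eq_iff]
      rintro (h | h)
      · exact he0 h.symm
      · exact he0 (by simpa using h.symm)
    · simp only [Finset.mem_insert, Finset.mem_singleton, forall_eq_or_imp, forall_eq, hinter]
      simp [he]
    · simp only [Finset.mem_insert, Finset.mem_singleton, forall_eq_or_imp, forall_eq, hdisj]
      rw [map_sub_rev p (-e) e, hee]
      norm_num
  obtain ⟨u, I, hI, hIcard⟩ := hζ.1
  choose off hoff using exists_translateVertex_eq (C := C)
  have hcard : (I.image fun s => off s - off u).card = ζ := by
    rw [← hIcard]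
    refine Finset.card_image_of_injective _ fun s t h => ?_
    rw [← hoff s, ← hoff t, sub_left_inj.1 h]
  obtain ⟨t, ht⟩ := exists_iterate_farthest_lt_of_separated hp hc
    (I.image fun s => off s - off u) (by omega)
    (by
      intro v hv
      obtain ⟨s, hs, rfl⟩ := Finset.mem_image.1 hv
      rw [map_sub_rev, ← hinter, hoff, hoff]
      exact hI.intersects_core s hs)
    (by
      intro v hv w hw hvw
      obtain ⟨s, hs, rfl⟩ := Finset.mem_image.1 hv
      obtain ⟨s', hs', rfl⟩ := Finset.mem_image.1 hw
      rw [sub_sub_sub_cancel_right, ← hdisj, hoff, hoff]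
      exact hI.nontouching s hs s' hs' fun h => hvw (by rw [h]))
  obtain ⟨n, rfl⟩ : ∃ n, ζ = n + 1 := ⟨ζ - 1, by omega⟩
  rw [hcard] at ht
  obtain ⟨x, hx⟩ := _root_.exists_isKissingPath hp hc n ht
  refine ⟨p, n, x, by omega, rfl, hx, fun v w => ?_⟩
  rw [← hinter, ← hinj.ne_iff]
  rfl

end Translates

/-! ### The two lower bounds -/

section LowerBound

variable {V : Type*} {G : SimpleGraph V} {p : Seminorm ℝ Plane} {x : ℕ → Plane} {M : ℕ}
  {vert : Plane → V}

theorem IsKissingPath.isInducedPath (h : IsKissingPath p x M) (hM : 2 ≤ M)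
    (hvert : Function.Injective vert)
    (hadj : ∀ v w, G.Adj (vert v) (vert w) ↔ v ≠ w ∧ p (v - w) ≤ 1) :
    IsInducedPath G (fun k => vert (x k)) (M + 1) where
  adj i hi := (hadj _ _).2 ⟨h.ne hM (Nat.lt_succ_self i) (by omega), h.near i (by omega)⟩
  not_adj i j hij hj hG := (h.far i j hij (by omega)).not_ge ((hadj _ _).1 hG).2
  ne i j hij hj := hvert.ne (h.ne hM hij (by omega))

/-- On inputs with a dominating vertex, any online algorithm can be forced to take `M` vertices. -/
theorem IsKissingPath.exists_input_one (h : IsKissingPath p x M) (hM : 2 ≤ M)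
    (hvert : Function.Injective vert)
    (hadj : ∀ v w, G.Adj (vert v) (vert w) ↔ v ≠ w ∧ p (v - w) ≤ 1) (A : OnlineCDSAlgorithm G) :
    ∃ l, IsInputSequence G l ∧ optCDS G {v | v ∈ l} = 1 ∧ M ≤ (A.solution l).card := by
  have h0 : ∀ i, i ≤ M → (0 : Plane) ≠ x i := fun i hi => (h.ne_zero i hi).symm
  have h0adj : ∀ i, i ≤ M → G.Adj (vert 0) (vert (x i)) := fun i hi =>
    (hadj _ _).2 ⟨h0 i hi, by rw [zero_sub, map_neg_eq_map]; exact h.le_one hi⟩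
  obtain ⟨hl, hcard⟩ := (h.isInducedPath hM hvert hadj).exists_isInputSequence A
    (fun _ => vert 0) 1 (fun _ _ => ⟨0, by omega, h0adj 0 (by omega)⟩)
    (fun _ _ i hi => hvert.ne (h0 i hi)) (fun i j hij hj => by omega)
  refine ⟨_, hl, ?_, hcard⟩
  have hD : IsConnectedDominatingSet G {v | v ∈ (List.range (M + 1)).map (fun k => vert (x k)) ++
      (List.range 1).map fun _ => vert 0} {vert 0} := by
    refine ⟨by simp, fun v hv => ?_, ?_⟩
    · rcases List.mem_append.1 hv with hv | hv
      · obtain ⟨i, hi, rfl⟩ := List.mem_map.1 hv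
        rw [List.mem_range] at hi
        exact Or.inr ⟨vert 0, by simp, (h0adj i (by omega)).symm⟩
      · obtain ⟨i, hi, rfl⟩ := List.mem_map.1 hv
        simp
    · have : {v | v ∈ ({vert 0} : Finset V)} = {v | v = vert 0} := by ext; simp
      rw [this]
      exact induce_singleton_connected _
  exact le_antisymm (by simpa using optCDS_le hD) (le_optCDS hD fun D' hD' => hD'.card_pos)

/-- Quotient and remainder modulo `M + 1` are the block and the position in it, so successive
indices are neighbours in one block or form a link. -/
theorem IsKissingPath.isInducedPath_chain (h : IsKissingPath p x M) (hM : 2 ≤ M)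
    (hvert : Function.Injective vert)
    (hadj : ∀ v w, G.Adj (vert v) (vert w) ↔ v ≠ w ∧ p (v - w) ≤ 1) (n : ℕ) :
    IsInducedPath G (fun k => vert (chainVertex x M (k / (M + 1)) (k % (M + 1)))) n := by
  have hmod : ∀ k, k % (M + 1) ≤ M := fun k => Nat.lt_succ_iff.1 (Nat.mod_lt k (by omega))
  have hdiv : ∀ k, (M + 1) * (k / (M + 1)) + k % (M + 1) = k := fun k => Nat.div_add_mod k _
  have hcase : ∀ k l, k < l →
      (k / (M + 1) = l / (M + 1) ∧ k % (M + 1) < l % (M + 1) ∧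
        l % (M + 1) - k % (M + 1) = l - k) ∨ k / (M + 1) < l / (M + 1) := by
    intro k l hkl
    rcases (Nat.div_le_div_right hkl.le : k / (M + 1) ≤ l / (M + 1)).eq_or_lt with e | hlt
    · have h1 := hdiv k
      have h2 := hdiv l
      rw [e] at h1
      exact Or.inl ⟨e, by omega, by omega⟩
    · exact Or.inr hlt
  have hlink : ∀ k l, l / (M + 1) = k / (M + 1) + 1 ∧ k % (M + 1) = M ∧ l % (M + 1) = 0 →
      l = k + 1 := by
    rintro k l ⟨h1, h2, h3⟩
    have h4 := hdiv k
    have h5 := hdiv l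
    rw [h1, h3, mul_add] at h5
    omega
  have hsucc : ∀ k, k / (M + 1) < (k + 1) / (M + 1) →
      (k + 1) / (M + 1) = k / (M + 1) + 1 ∧ k % (M + 1) = M ∧ (k + 1) % (M + 1) = 0 := by
    intro k hk
    have h1 := hdiv k
    have h2 := hdiv (k + 1)
    have h3 := hmod k
    have h4 : (M + 1) * (k / (M + 1)) + (M + 1) ≤ (M + 1) * ((k + 1) / (M + 1)) := by
      rw [← Nat.mul_succ]; exact Nat.mul_le_mul_left _ hk
    have h5 : k % (M + 1) = M := by omega
    have h6 : (k + 1) % (M + 1) = 0 := by omega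
    refine ⟨Nat.eq_of_mul_eq_mul_left (Nat.succ_pos M) ?_, h5, h6⟩
    rw [Nat.succ_eq_add_one, mul_add]
    omega
  refine ⟨fun k _ => (hadj _ _).2 ?_, fun k l hkl _ hG => ?_, fun k l hkl _ => hvert.ne ?_⟩
  · rcases hcase k (k + 1) (by omega) with ⟨h1, h2, h3⟩ | h1
    · rw [← h1]
      have e : (k + 1) % (M + 1) = k % (M + 1) + 1 := by omega
      have := hmod (k + 1)
      rw [e] at this ⊢
      exact ⟨h.chainVertex_ne hM _ (Nat.lt_succ_self _) this, h.chainVertex_near _ this⟩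
    · obtain ⟨h1, h2, h3⟩ := hsucc k h1
      rw [h1, h2, h3]
      have := h.chainVertex_link (k / (M + 1))
      refine ⟨fun e => ?_, this.le⟩
      rw [e, sub_self, map_zero] at this
      norm_num at this
  · have hle := ((hadj _ _).1 hG).2
    rcases hcase k l (by omega) with ⟨h1, h2, h3⟩ | h1
    · rw [← h1] at hle
      exact (h.chainVertex_far _ (by omega) (hmod l)).not_ge hle
    · refine (h.one_lt_chainVertex hM h1 (hmod k) (hmod l) fun e => ?_).not_ge hle
      have := hlink k l e
      omega
  · rcases hcase k l hkl with ⟨h1, h2, h3⟩ | h1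
    · rw [← h1]
      exact h.chainVertex_ne hM _ h2 (hmod l)
    · intro e
      by_cases hl : l / (M + 1) = k / (M + 1) + 1 ∧ k % (M + 1) = M ∧ l % (M + 1) = 0
      · have := h.chainVertex_link (k / (M + 1))
        rw [hl.1, hl.2.1, hl.2.2] at e
        rw [e, sub_self, map_zero] at this
        norm_num at this
      · have := h.one_lt_chainVertex hM h1 (hmod k) (hmod l) hl
        rw [e, sub_self, map_zero] at this
        linarith

/-- A chain of `N + 1` blocks has an optimum between `N + 1` and `3 * (N + 1)`, and any online
algorithm can be forced to take all path vertices but one. -/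
theorem IsKissingPath.exists_input_chain (h : IsKissingPath p x M) (hM : 2 ≤ M)
    (hvert : Function.Injective vert)
    (hadj : ∀ v w, G.Adj (vert v) (vert w) ↔ v ≠ w ∧ p (v - w) ≤ 1) (A : OnlineCDSAlgorithm G)
    (N : ℕ) :
    ∃ l, IsInputSequence G l ∧ N + 1 ≤ optCDS G {v | v ∈ l} ∧
      optCDS G {v | v ∈ l} ≤ 3 * (N + 1) ∧
      (M + 1) * (N + 1) ≤ (A.solution l).card + 1 := by
  classical
  set y : ℕ → V := fun k => vert (chainVertex x M (k / (M + 1)) (k % (M + 1))) with hy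
  set u : ℕ → V := fun j => vert (chainCenter (x 0) (x M) j) with hu
  have hmod : ∀ k, k % (M + 1) ≤ M := fun k => Nat.lt_succ_iff.1 (Nat.mod_lt k (by omega))
  have hyb : ∀ j i, i ≤ M → y ((M + 1) * j + i) = vert (chainVertex x M j i) := by
    intro j i hi
    have h1 : ((M + 1) * j + i) / (M + 1) = j := by
      rw [Nat.mul_add_div (by omega), Nat.div_eq_of_lt (by omega), add_zero]
    have h2 : ((M + 1) * j + i) % (M + 1) = i := by
      rw [Nat.mul_add_mod, Nat.mod_eq_of_lt (by omega)]
    simp only [hy, h1, h2]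
  have hlen : ∀ j i, j ≤ N → i ≤ M → (M + 1) * j + i ≤ (M + 1) * N + M := fun j i hj hi =>
    Nat.add_le_add (Nat.mul_le_mul_left _ hj) hi
  have huadj : ∀ j i, i ≤ M → G.Adj (u j) (vert (chainVertex x M j i)) := fun j i hi =>
    (hadj _ _).2 ⟨h.chainCenter_ne_chainVertex hM j hi, h.chainCenter_sub_chainVertex j hi⟩
  have huu : ∀ i j, i < j → u i ≠ u j := fun i j hij => hvert.ne fun e => by
    have := h.three_le_chainCenter hM hij
    rw [e, sub_self, map_zero] at this
    linarith
  obtain ⟨hl, hcard⟩ := (h.isInducedPath_chain hM hvert hadj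
    ((M + 1) * N + M + 1)).exists_isInputSequence A u (N + 1)
    (fun j hj => ⟨(M + 1) * j + 0, hlen j 0 (by omega) (by omega), by
      have := hyb j 0 (by omega)
      simp only [hy] at this
      rw [this]
      exact huadj j 0 (by omega)⟩)
    (fun j hj i hi => hvert.ne (h.chainCenter_ne_chainVertex hM j (hmod i)))
    (fun i j hij _ => huu i j hij)
  set l : List V := (List.range ((M + 1) * N + M + 1)).map y ++ (List.range (N + 1)).map u with hl'
  have hmeml : ∀ v, v ∈ l ↔ (∃ j i, j ≤ N ∧ i ≤ M ∧ vert (chainVertex x M j i) = v) ∨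
      ∃ j, j ≤ N ∧ u j = v := by
    intro v
    simp only [hl', List.mem_append, List.mem_map, List.mem_range, Nat.lt_succ_iff]
    refine or_congr ⟨?_, ?_⟩ Iff.rfl
    · rintro ⟨k, hk, rfl⟩
      refine ⟨k / (M + 1), k % (M + 1), ?_, hmod k, rfl⟩
      rw [← Nat.lt_succ_iff]
      apply Nat.div_lt_of_lt_mul
      rw [Nat.succ_eq_add_one, mul_add]
      omega
    · rintro ⟨j, i, hj, hi, rfl⟩
      exact ⟨(M + 1) * j + i, hlen j i hj hi, hyb j i hi⟩
  -- the connected dominating set runs through the ends and centres of the blocks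
  set z : ℕ → V := fun k => if k % 3 = 0 then vert (chainVertex x M (k / 3) 0) else
    if k % 3 = 1 then u (k / 3) else vert (chainVertex x M (k / 3) M) with hz
  have hz0 : ∀ j, z (3 * j) = vert (chainVertex x M j 0) := fun j => by
    simp [hz]
  have hz1 : ∀ j, z (3 * j + 1) = u j := fun j => by
    have h1 : (3 * j + 1) % 3 = 1 := by omega
    have h2 : (3 * j + 1) / 3 = j := by omega
    simp [hz, h1, h2]
  have hz2 : ∀ j, z (3 * j + 2) = vert (chainVertex x M j M) := fun j => by
    have h1 : (3 * j + 2) % 3 = 2 := by omega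
    have h2 : (3 * j + 2) / 3 = j := by omega
    simp [hz, h1, h2]
  have hzcases : ∀ k, ∃ j, k = 3 * j ∨ k = 3 * j + 1 ∨ k = 3 * j + 2 := fun k =>
    ⟨k / 3, by omega⟩
  have hzadj : ∀ k, G.Adj (z k) (z (k + 1)) := by
    intro k
    obtain ⟨j, rfl | rfl | rfl⟩ := hzcases k
    · rw [hz0, hz1]
      exact (huadj j 0 (by omega)).symm
    · rw [hz1, hz2]
      exact huadj j M le_rfl
    · rw [hz2, show 3 * j + 2 + 1 = 3 * (j + 1) by ring, hz0]
      have := h.chainVertex_link j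
      refine (hadj _ _).2 ⟨fun e => ?_, this.le⟩
      rw [e, sub_self, map_zero] at this
      norm_num at this
  have hD : IsConnectedDominatingSet G {v | v ∈ l}
      ((Finset.range (3 * (N + 1))).image z) := by
    refine ⟨fun v hv => ?_, fun v hv => ?_, ?_⟩
    · obtain ⟨k, hk, rfl⟩ := Finset.mem_image.1 hv
      rw [Finset.mem_range] at hk
      refine (hmeml _).2 ?_
      obtain ⟨j, rfl | rfl | rfl⟩ := hzcases k
      · exact Or.inl ⟨j, 0, by omega, by omega, (hz0 j).symm⟩
      · exact Or.inr ⟨j, by omega, (hz1 j).symm⟩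
      · exact Or.inl ⟨j, M, by omega, le_rfl, (hz2 j).symm⟩
    · have hmem : ∀ j, j ≤ N → u j ∈ (Finset.range (3 * (N + 1))).image z := fun j hj =>
        Finset.mem_image.2 ⟨3 * j + 1, Finset.mem_range.2 (by omega), hz1 j⟩
      rcases (hmeml v).1 hv with ⟨j, i, hj, hi, rfl⟩ | ⟨j, hj, rfl⟩
      · exact Or.inr ⟨u j, hmem j hj, (huadj j i hi).symm⟩
      · exact Or.inl (hmem j hj)
    · have e : {v | v ∈ (Finset.range (3 * (N + 1))).image z} =
          {v | ∃ k, k ≤ 3 * N + 2 ∧ z k = v} := by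
        ext v
        simp only [Finset.mem_image, Finset.mem_range, Set.mem_ofPred_eq]
        exact exists_congr fun k => and_congr_left fun _ => by omega
      rw [e]
      exact induce_walk_connected z (3 * N + 2) fun k _ => hzadj k
  refine ⟨l, hl, le_optCDS hD fun D' hD' => ?_, (optCDS_le hD).trans ?_, ?_⟩
  · have hsurj : ∀ v, ∃ c : Plane, v ∈ D' → vert c = v := by
      intro v
      by_cases hv : v ∈ D'
      · rcases (hmeml v).1 (hD'.subset v hv) with ⟨j, i, _, _, e⟩ | ⟨j, _, e⟩
        · exact ⟨_, fun _ => e⟩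
        · exact ⟨_, fun _ => e⟩
      · exact ⟨0, fun h' => absurd h' hv⟩
    choose pos hpos using hsurj
    have hdom : ∀ j, ∃ d, j ≤ N → d ∈ D' ∧ p (chainCenter (x 0) (x M) j - pos d) ≤ 1 := by
      intro j
      by_cases hj : j ≤ N
      · rcases hD'.dominating (u j) ((hmeml _).2 (Or.inr ⟨j, hj, rfl⟩)) with hd | ⟨d, hd, hadj'⟩
        · refine ⟨u j, fun _ => ⟨hd, ?_⟩⟩
          rw [hvert (hpos _ hd), sub_self, map_zero]
          exact zero_le_one
        · refine ⟨d, fun _ => ⟨hd, ?_⟩⟩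
          rw [← hpos d hd] at hadj'
          exact ((hadj _ _).1 hadj').2
      · exact ⟨u j, fun h' => absurd h' hj⟩
    choose d hd using hdom
    -- A common dominator would put two centres within distance 2, but they are at distance at least
    -- 3.
    have hsep : ∀ i j, i < j → j ≤ N → d i ≠ d j := by
      intro i j hij hj e
      have h1 := (hd i (by omega)).2
      have h2 := (hd j hj).2
      have h3 := h.three_le_chainCenter hM hij
      rw [← e] at h2
      have h4 := map_sub_le_add p (chainCenter (x 0) (x M) i - pos (d i))
        (chainCenter (x 0) (x M) j - pos (d i))
      rw [sub_sub_sub_cancel_right] at h4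
      linarith
    calc N + 1 = ((Finset.range (N + 1)).image d).card := by
          rw [Finset.card_image_of_injOn, Finset.card_range]
          intro i hi j hj hij
          simp only [Finset.coe_range, Set.mem_Iio] at hi hj
          rcases Nat.lt_trichotomy i j with hlt | rfl | hlt
          · exact absurd hij (hsep i j hlt (by omega))
          · rfl
          · exact absurd hij.symm (hsep j i hlt (by omega))
      _ ≤ D'.card := by
          refine Finset.card_le_card fun v hv => ?_
          obtain ⟨j, hj, rfl⟩ := Finset.mem_image.1 hv
          rw [Finset.mem_range] at hj
          exact (hd j (by omega)).1
  · exact Finset.card_image_le.trans (by simp)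
  · rw [mul_add]
    omega

end LowerBound

theorem mainTheorem4 (C : Set Plane) (hC : IsConvexObject C) (ζ : ℕ)
    (hζ : IsIndependentKissingNumber (translates C) ζ)
    (A : OnlineCDSAlgorithm (intersectionGraph (translates C))) :
    (∀ α : ℝ, A.IsCompetitive (fun opt => opt = 1) α → 2 * ((ζ : ℝ) - 1) ≤ α) ∧
    (∀ k : ℕ, ∀ α : ℝ, A.IsCompetitive (fun opt => k ≤ opt) α →
      (2 * (ζ : ℝ) - 1) / 3 ≤ α) := by
  obtain ⟨p, n, x, hn, rfl, hx, hadj⟩ := hC.exists_isKissingPath hζ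
  have hinj := hC.translateVertex_injective
  refine ⟨fun α hα => ?_, fun k α hα => ?_⟩
  · obtain ⟨l, hl, hopt, hcard⟩ := hx.exists_input_one (by omega) hinj hadj A
    have h1 := hα l hl hopt
    rw [hopt] at h1
    have h2 : ((2 * n : ℕ) : ℝ) ≤ (A.solution l).card := by exact_mod_cast hcard
    push_cast at h1 h2 ⊢
    linarith
  · by_contra! hlt
    -- With `k + K + 1` blocks, competitiveness gives `(k + K + 1) * (2 * n + 1 - 3 * α) ≤ 1`, where
    -- the 1 is the path vertex not forced; this `K` contradicts it.
    obtain ⟨K, hK⟩ := exists_nat_gt (1 / ((2 * n + 1 : ℝ) - 3 * α))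
    push_cast at hlt
    have hpos : 0 < (2 * n + 1 : ℝ) - 3 * α := by linarith
    obtain ⟨l, hl, hopt, hopt', hcard⟩ := hx.exists_input_chain (by omega) hinj hadj A (k + K)
    have h1 := hα l hl (show k ≤ _ by omega)
    set o := optCDS (intersectionGraph (translates C)) {v | v ∈ l}
    have h2 : ((2 * n + 1) * ((k + K : ℕ) + 1) : ℝ) ≤ (A.solution l).card + 1 := by
      exact_mod_cast hcard
    have h3 : (o : ℝ) ≤ 3 * ((k + K : ℕ) + 1) := by exact_mod_cast hopt'
    have h4 : (1 : ℝ) ≤ o := by exact_mod_cast (by omega : 1 ≤ o)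
    have hα0 : 0 ≤ α := by
      by_contra! hneg
      have : (0 : ℝ) ≤ (A.solution l).card := Nat.cast_nonneg _
      nlinarith
    rw [div_lt_iff₀ hpos] at hK
    have h5 : (K : ℝ) ≤ (k + K : ℕ) := by exact_mod_cast (by omega : K ≤ k + K)
    have h6 := mul_le_mul_of_nonneg_left h3 hα0
    have h7 := mul_le_mul_of_nonneg_right h5 hpos.le
    nlinarith
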